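/- Let $(\Omega,dx)$ be a finite measure space, $|\Omega|<\infty$ (for instance a metric measure space of finite measure). Let $1\le p<\infty$ with conjugate exponent $p'$, let $1<\rho<\infty$, and let $h\in L^\infty(\Omega)$. Let $J:\Omega\times\Omega\to\mathbb{R}$ be measurable with $J(x,y)=J(y,x)$ and $J(x,y)\ge 0$ for a.e. $(x,y)$, and $J\in L^\infty(\Omega,L^1(\Omega))\cap L^p(\Omega,L^{p'}(\Omega))$, i.e. the norms $\big\|x\mapsto\|J(x,\cdot)\|_{L^1(\Omega)}\big\|_{L^\infty(\Omega)}$ and $\big\|x\mapsto\|J(x,\cdot)\|_{L^{p'}(\Omega)}\big\|_{L^p(\Omega)}$ are finite. Put $Ku(x)=\int_\Omega J(x,y)u(y)\,dy$ and $L=K-hI$, a bounded operator on $L^p(\Omega)$. Let $f:\Omega\times\mathbb{R}\to\mathbb{R}$ be such that $f(\cdot,s)$ is measurable for every $s$; $f(x,s)$ is locally Lipschitz in $s$, uniformly in $x$ (for every $R$ there is $M_R$ such that for a.e. $x$ the function $f(x,\cdot)$ is $M_R$-Lipschitz on $[-R,R]$); $f(\cdot,0)\in L^\infty(\Omega)$;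 and, for some $\beta\in L^\infty(\Omega)$ and some constant $C$, for a.e. $x\in\Omega$ and a.e. $s\in\mathbb{R}$, $$\frac{\partial f}{\partial s}(x,s)\le\beta(x),\qquad \Big|\frac{\partial f}{\partial s}(x,s)\Big|\le C\big(1+|s|^{\rho-1}\big).$$ Then for every $u_0\in L^{p\rho}(\Omega)$ there is a global solution $u:[0,\infty)\to L^{p\rho}(\Omega)$ of $$u_t(x,t)=Lu(x,t)+f(x,u(x,t)),\quad t>0,\qquad u(x,0)=u_0(x),$$ such that for every $T>0$: $u\in C([0,T],L^{p\rho}(\Omega))\cap C^1([0,T],L^p(\Omega))$; $u$ is given by the variation of constants formula $$u(\cdot,t)=e^{Lt}u_0+\int_0^t e^{L(t-s)}f(\cdot,u(\cdot,s))\,ds,\qquad t\in[0,T],$$ understood in $L^p(\Omega)$, with $s\mapsto f(\cdot,u(\cdot,s))$ integrable from $[0,T]$ into $L^p(\Omega)$; and $u$ is a strong solution in $L^p(\Omega)$, that is, $u(0)=u_0$ and $u_t=Lu+f(\cdot,u)$ holds in $L^p(\Omega)$ for every $t\in[0,T]$ (with one-sided derivatives at the ends). This solution is unique: for every $T>0$,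 any $v\in C([0,T],L^{p\rho}(\Omega))$ that satisfies the variation of constants formula on $[0,T]$, and any $v\in C([0,T],L^{p\rho}(\Omega))\cap C^1([0,T],L^p(\Omega))$ that is a strong solution in $L^p(\Omega)$ on $[0,T]$ with $v(0)=u_0$, coincides with $u$ on $[0,T]$. -/

import Mathlib

open MeasureTheory Set Filter Topology
open scoped ENNReal NNReal

namespace NonlocalDiffusion

noncomputable section

/-- `J ∈ L^a(Ω, L^b(Ω))`: the kernel `J` is (a.e. strongly) measurable on the product space and
its mixed norm `‖ x ↦ ‖J(x, ·)‖_{L^b(Ω)} ‖_{L^a(Ω)}` is finite. -/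
def KernelMemLp {Ω : Type*} [MeasurableSpace Ω] (J : Ω → Ω → ℝ) (a b : ℝ≥0∞) (μ : Measure Ω) :
    Prop :=
  AEStronglyMeasurable (Function.uncurry J) (μ.prod μ) ∧
    eLpNorm (fun x => eLpNorm (J x) b μ) a μ < ⊤

section multiplication

variable {Ω : Type*} [MeasurableSpace Ω] {μ : Measure Ω} {p : ℝ≥0∞} [Fact (1 ≤ p)]

/-- The multiplication operator `v ↦ h v` on `L^p(Ω)`, for `h ∈ L^∞(Ω)`. -/
def mulOp {h : Ω → ℝ} (hh : MemLp h ⊤ μ) : Lp ℝ p μ →L[ℝ] Lp ℝ p μ :=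
  (ContinuousLinearMap.mul ℝ ℝ).holderL μ ⊤ p p (hh.toLp h)

lemma coeFn_mulOp {h : Ω → ℝ} (hh : MemLp h ⊤ μ) (v : Lp ℝ p μ) :
    mulOp hh v =ᵐ[μ] fun x => h x * v x := by
  have h1 := (ContinuousLinearMap.mul ℝ ℝ).coeFn_holder (r := p) (hh.toLp h) v
  filter_upwards [h1, hh.coeFn_toLp] with x hx hx2
  exact hx.trans (by rw [hx2]; rfl)

end multiplication

section operators

variable {Ω : Type*} [MeasurableSpace Ω] {μ : Measure Ω} [SFinite μ]
  {p : ℝ≥0∞} [Fact (1 ≤ p)] {J : Ω → Ω → ℝ}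

/-- For almost every `x`, the function `y ↦ J(x, y) v(y)` is integrable when `v ∈ L^p(Ω)`. -/
lemma KernelMemLp.ae_integrable (hJ : KernelMemLp J p p.conjExponent μ) {v : Ω → ℝ}
    (hv : MemLp v p μ) : ∀ᵐ x ∂μ, Integrable (fun y => J x y * v y) μ := by
  rcases eq_or_ne (eLpNorm v p μ) 0 with h0 | h0
  · have hp0 : p ≠ 0 := (lt_of_lt_of_le zero_lt_one (Fact.out : 1 ≤ p)).ne'
    have hv0 : v =ᵐ[μ] 0 := (eLpNorm_eq_zero_iff hv.1 hp0).1 h0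
    refine Eventually.of_forall fun x => ?_
    refine (integrable_zero Ω ℝ μ).congr ?_
    filter_upwards [hv0] with y hy
    simp [hy]
  · have hm : ∀ᵐ x ∂μ, AEStronglyMeasurable (J x) μ := hJ.1.prodMk_left
    have hI : AEStronglyMeasurable (fun z : Ω × Ω => J z.1 z.2 * v z.2) (μ.prod μ) :=
      hJ.1.mul hv.1.comp_snd
    have hmeas : AEMeasurable (fun x => ∫⁻ y, ‖J x y * v y‖ₑ ∂μ) μ :=
      hI.enorm.lintegral_prod_right'
    have hle : ∀ᵐ x ∂μ, ‖∫⁻ y, ‖J x y * v y‖ₑ ∂μ‖ₑ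
        ≤ ((eLpNorm v p μ).toNNReal : ℝ≥0∞) * ‖eLpNorm (J x) p.conjExponent μ‖ₑ := by
      filter_upwards [hm] with x hx
      rw [ENNReal.coe_toNNReal hv.2.ne, enorm_eq_self, enorm_eq_self, mul_comm]
      have := eLpNorm_smul_le_mul_eLpNorm (p := p.conjExponent) (q := p) (r := 1) hv.1 hx
      rwa [eLpNorm_one_eq_lintegral_enorm] at this
    have hfin : eLpNorm (fun x => ∫⁻ y, ‖J x y * v y‖ₑ ∂μ) p μ < ⊤ :=
      (eLpNorm_le_mul_eLpNorm_of_ae_le_mul' hle p).trans_lt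
        (ENNReal.mul_lt_top ENNReal.coe_lt_top hJ.2)
    have hae : ∀ᵐ x ∂μ, ∫⁻ y, ‖J x y * v y‖ₑ ∂μ < ⊤ := by
      rcases eq_or_ne p ⊤ with hp | hp
      · subst hp
        rw [eLpNorm_exponent_top] at hfin
        filter_upwards [ae_lt_of_essSup_lt hfin] with x hx
        simpa using hx
      · have hp0 : p ≠ 0 := (lt_of_lt_of_le zero_lt_one (Fact.out : 1 ≤ p)).ne'
        have h1 := lintegral_rpow_enorm_lt_top_of_eLpNorm_lt_top hp0 hp hfin
        have h2 := ae_lt_top' (hmeas.enorm.pow_const _) h1.ne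
        filter_upwards [h2] with x hx
        have hpos : 0 < p.toReal := ENNReal.toReal_pos hp0 hp
        by_contra hcon
        rw [not_lt, top_le_iff] at hcon
        rw [enorm_eq_self, hcon, ENNReal.top_rpow_of_pos hpos] at hx
        exact lt_irrefl _ hx
    filter_upwards [hm, hae] with x hx hx2
    exact ⟨hx.mul hv.1, hx2⟩

/-- Hölder's inequality for the nonlocal operator. -/
lemma KernelMemLp.ae_enorm_le (hJ : KernelMemLp J p p.conjExponent μ) {v : Ω → ℝ}
    (hv : MemLp v p μ) :
    ∀ᵐ x ∂μ, ‖∫ y, J x y * v y ∂μ‖ₑ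
      ≤ ((eLpNorm v p μ).toNNReal : ℝ≥0∞) * ‖eLpNorm (J x) p.conjExponent μ‖ₑ := by
  have hm : ∀ᵐ x ∂μ, AEStronglyMeasurable (J x) μ := hJ.1.prodMk_left
  filter_upwards [hm] with x hx
  rw [ENNReal.coe_toNNReal hv.2.ne, enorm_eq_self, mul_comm]
  refine (enorm_integral_le_lintegral_enorm _).trans ?_
  have := eLpNorm_smul_le_mul_eLpNorm (p := p.conjExponent) (q := p) (r := 1) hv.1 hx
  rwa [eLpNorm_one_eq_lintegral_enorm] at this

lemma KernelMemLp.eLpNorm_le (hJ : KernelMemLp J p p.conjExponent μ) {v : Ω → ℝ}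
    (hv : MemLp v p μ) :
    eLpNorm (fun x => ∫ y, J x y * v y ∂μ) p μ
      ≤ eLpNorm (fun x => eLpNorm (J x) p.conjExponent μ) p μ * eLpNorm v p μ := by
  have := eLpNorm_le_mul_eLpNorm_of_ae_le_mul' (hJ.ae_enorm_le hv) p
  rwa [ENNReal.coe_toNNReal hv.2.ne, mul_comm] at this

lemma KernelMemLp.memLp (hJ : KernelMemLp J p p.conjExponent μ) {v : Ω → ℝ}
    (hv : MemLp v p μ) : MemLp (fun x => ∫ y, J x y * v y ∂μ) p μ := by
  have hI : AEStronglyMeasurable (fun z : Ω × Ω => J z.1 z.2 * v z.2) (μ.prod μ) :=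
    hJ.1.mul hv.1.comp_snd
  exact ⟨hI.integral_prod_right', (hJ.eLpNorm_le hv).trans_lt (ENNReal.mul_lt_top hJ.2 hv.2)⟩

/-- The nonlocal operator `K v (x) = ∫ J(x, y) v(y) dy` as a bounded operator on `L^p(Ω)`. -/
def nonlocalK (hJ : KernelMemLp J p p.conjExponent μ) : Lp ℝ p μ →L[ℝ] Lp ℝ p μ :=
  LinearMap.mkContinuous
    { toFun := fun v => (hJ.memLp (Lp.memLp v)).toLp
      map_add' := fun v w => by
        rw [← MemLp.toLp_add]
        apply MemLp.toLp_congr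
        filter_upwards [hJ.ae_integrable (Lp.memLp v), hJ.ae_integrable (Lp.memLp w)] with x hv hw
        simp only [Pi.add_apply]
        rw [← integral_add hv hw]
        apply integral_congr_ae
        filter_upwards [Lp.coeFn_add v w] with y hy
        rw [hy, Pi.add_apply, mul_add]
      map_smul' := fun c v => by
        rw [RingHom.id_apply, ← MemLp.toLp_const_smul]
        apply MemLp.toLp_congr
        refine Eventually.of_forall fun x => ?_
        simp only [Pi.smul_apply, smul_eq_mul]
        rw [← integral_const_mul]
        apply integral_congr_ae
        filter_upwards [Lp.coeFn_smul c v] with y hy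
        rw [hy, Pi.smul_apply, smul_eq_mul]
        ring }
    (eLpNorm (fun x => eLpNorm (J x) p.conjExponent μ) p μ).toReal
    (fun v => by
      simp only [LinearMap.coe_mk, AddHom.coe_mk]
      rw [Lp.norm_toLp, Lp.norm_def, ← ENNReal.toReal_mul]
      exact ENNReal.toReal_mono (ENNReal.mul_lt_top hJ.2 (Lp.memLp v).2).ne
        (hJ.eLpNorm_le (Lp.memLp v)))

lemma coeFn_nonlocalK (hJ : KernelMemLp J p p.conjExponent μ) (v : Lp ℝ p μ) :
    nonlocalK hJ v =ᵐ[μ] fun x => ∫ y, J x y * v y ∂μ :=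
  MemLp.coeFn_toLp (hJ.memLp (Lp.memLp v))

/-- The bounded operator `L = K - h I` on `L^p(Ω)`. -/
def linOp (hJ : KernelMemLp J p p.conjExponent μ) {h : Ω → ℝ} (hh : MemLp h ⊤ μ) :
    Lp ℝ p μ →L[ℝ] Lp ℝ p μ :=
  nonlocalK hJ - mulOp hh

/-- `L v (x) = ∫ J(x, y) v(y) dy - h(x) v(x)`. -/
lemma coeFn_linOp (hJ : KernelMemLp J p p.conjExponent μ) {h : Ω → ℝ} (hh : MemLp h ⊤ μ)
    (v : Lp ℝ p μ) :
    linOp hJ hh v =ᵐ[μ] fun x => (∫ y, J x y * v y ∂μ) - h x * v x := by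
  have h1 : linOp hJ hh v = nonlocalK hJ v - mulOp hh v := rfl
  rw [h1]
  filter_upwards [Lp.coeFn_sub (nonlocalK hJ v) (mulOp hh v), coeFn_nonlocalK hJ v,
    coeFn_mulOp hh v] with x a b c
  rw [a, Pi.sub_apply, b, c]

end operators

section exponents

variable {p : ℝ≥0∞} {ρ : ℝ}

lemma le_mul_ofReal (p : ℝ≥0∞) (ρ : ℝ) [hρ : Fact (1 < ρ)] : p ≤ p * ENNReal.ofReal ρ := by
  conv_lhs => rw [← mul_one p]
  gcongr
  rw [← ENNReal.ofReal_one]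
  exact ENNReal.ofReal_le_ofReal hρ.out.le

/-- The exponent `p ρ` is at least `1`, so `L^{pρ}(Ω)` is a normed space. -/
instance fact_one_le_mul_ofReal [hp : Fact (1 ≤ p)] [Fact (1 < ρ)] :
    Fact (1 ≤ p * ENNReal.ofReal ρ) :=
  ⟨hp.out.trans (le_mul_ofReal p ρ)⟩

end exponents

section solutions

variable {Ω : Type*} [MeasurableSpace Ω] {μ : Measure Ω} [IsFiniteMeasure μ]
  {p : ℝ≥0∞} {ρ : ℝ} [Fact (1 < ρ)]

/-- The inclusion `L^{pρ}(Ω) ⊆ L^p(Ω)` on a finite measure space. It does not change the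
underlying class of functions. -/
def incl (v : Lp ℝ (p * ENNReal.ofReal ρ) μ) : Lp ℝ p μ :=
  AddSubgroup.inclusion (Lp.antitone (le_mul_ofReal p ρ)) v

lemma coeFn_incl (v : Lp ℝ (p * ENNReal.ofReal ρ) μ) : (incl v : Ω → ℝ) = (v : Ω → ℝ) := rfl

variable [Fact (1 ≤ p)] {J : Ω → Ω → ℝ} {h : Ω → ℝ}

/-- `u ∈ C([0,T], L^{pρ}(Ω))` is given by the variation of constants formula
`u(t) = e^{Lt} u₀ + ∫₀ᵗ e^{L(t-s)} f(·, u(·, s)) ds` on `[0,T]`, an identity in `L^p(Ω)`. Here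
`g(s)` is the class of `f(·, u(·, s))`, which is required to lie in `L^p(Ω)` for every `s` and to
be Bochner integrable on `[0,T]` as a function of `s`. -/
def IsMildSolution (hJ : KernelMemLp J p p.conjExponent μ) (hh : MemLp h ⊤ μ)
    (f : Ω → ℝ → ℝ) (u₀ : Lp ℝ (p * ENNReal.ofReal ρ) μ) (T : ℝ)
    (u : ℝ → Lp ℝ (p * ENNReal.ofReal ρ) μ) : Prop :=
  ContinuousOn u (Icc 0 T) ∧
    ∃ g : ℝ → Lp ℝ p μ, IntegrableOn g (Icc 0 T) ∧
      (∀ t ∈ Icc 0 T, g t =ᵐ[μ] fun x => f x (u t x)) ∧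
      ∀ t ∈ Icc 0 T, incl (u t) = NormedSpace.exp (t • linOp hJ hh) (incl u₀) +
        ∫ s in (0 : ℝ)..t, NormedSpace.exp ((t - s) • linOp hJ hh) (g s)

/-- `u ∈ C([0,T], L^{pρ}(Ω)) ∩ C¹([0,T], L^p(Ω))` is a strong solution in `L^p(Ω)` on `[0,T]` of
`u_t(x,t) = ∫ J(x,y) u(y,t) dy - h(x) u(x,t) + f(x, u(x,t))`, `u(x,0) = u₀(x)`. The function `u'`
is the time derivative of `u` as a map into `L^p(Ω)`, one-sided at the ends of `[0,T]`. -/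
def IsStrongSolution (J : Ω → Ω → ℝ) (h : Ω → ℝ) (f : Ω → ℝ → ℝ)
    (u₀ : Lp ℝ (p * ENNReal.ofReal ρ) μ) (T : ℝ)
    (u : ℝ → Lp ℝ (p * ENNReal.ofReal ρ) μ) : Prop :=
  ContinuousOn u (Icc 0 T) ∧ u 0 = u₀ ∧
    ∃ u' : ℝ → Lp ℝ p μ, ContinuousOn u' (Icc 0 T) ∧
      (∀ t ∈ Icc 0 T, HasDerivWithinAt (fun s => (incl (u s) : Lp ℝ p μ)) (u' t) (Icc 0 T) t) ∧
      ∀ t ∈ Icc 0 T, u' t =ᵐ[μ] fun x =>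
        (∫ y, J x y * u t y ∂μ) - h x * u t x + f x (u t x)

end solutions

end

end NonlocalDiffusion

open NonlocalDiffusion

/-
For bounded data the equation is an ordinary differential equation in `L^∞(Ω)` whose vector field
is locally Lipschitz. Truncating the solution inside the vector field makes it globally Lipschitz,
and the one-sided bound on `∂f/∂s`, which truncation preserves, gives an a priori bound under which
the truncation is inactive: bounded data have global solutions.

The same one-sided bound makes the reaction dissipative in every `L^q(Ω)`, up to an exponential
factor, while `K` is bounded on every `L^q(Ω)` by Schur's test. Bounded solutions therefore depend
continuously on their data in `L^{pρ}(Ω)`, and by density every datum is approached by bounded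
ones, whose solutions converge uniformly in `L^{pρ}(Ω)`. Since `v ↦ f(·, v)` is continuous from
`L^{pρ}(Ω)` to `L^p(Ω)`, the limit solves the equation in `L^p(Ω)`, where the dissipativity
estimate also gives uniqueness. Mild and strong solutions coincide because the right-hand side is
continuous in time.
-/

namespace NonlocalDiffusion

section RealFunctions

variable {g : ℝ → ℝ} {a b B : ℝ}

lemma sub_le_of_ae_deriv_le (hab : a ≤ b) (hg : AbsolutelyContinuousOnInterval g a b)
    (hB : ∀ᵐ s, s ∈ Icc a b → deriv g s ≤ B) : g b - g a ≤ B * (b - a) := by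
  have hint : ∫ x in a..b, deriv g x ≤ ∫ _ in a..b, B :=
    intervalIntegral.integral_mono_ae_restrict hab hg.intervalIntegrable_deriv
      intervalIntegrable_const ((ae_restrict_iff' measurableSet_Icc).2 hB)
  simpa [hg.integral_deriv_eq_sub, mul_comm] using hint

lemma abs_sub_le_of_ae_abs_deriv_le (hab : a ≤ b) (hg : AbsolutelyContinuousOnInterval g a b)
    (hB : ∀ᵐ s, s ∈ Icc a b → |deriv g s| ≤ B) : |g b - g a| ≤ B * (b - a) := by
  have hupper := sub_le_of_ae_deriv_le hab hg
    (hB.mono fun s hs hmem => (le_abs_self _).trans (hs hmem))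
  have hlower := sub_le_of_ae_deriv_le (g := -g) (B := B) hab hg.neg (hB.mono fun s hs hmem => by
    rw [deriv.neg]
    exact (neg_le_abs _).trans (hs hmem))
  simp only [Pi.neg_apply] at hlower
  exact abs_le.2 ⟨by linarith, hupper⟩

lemma absolutelyContinuousOnInterval_of_locallyLipschitz (hg : LocallyLipschitz g) (a b : ℝ) :
    AbsolutelyContinuousOnInterval g a b :=
  have ⟨_, hM⟩ := hg.locallyLipschitzOn.exists_lipschitzOnWith_of_compact isCompact_uIcc
  hM.absolutelyContinuousOnInterval

lemma sub_mul_sub_le_of_ae_deriv_le (hg : LocallyLipschitz g) (hB : ∀ᵐ s, deriv g s ≤ B)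
    (s r : ℝ) : (g s - g r) * (s - r) ≤ B * (s - r) ^ 2 := by
  wlog hrs : r ≤ s generalizing s r
  · linarith [this r s (le_of_not_ge hrs)]
  have hincr := sub_le_of_ae_deriv_le hrs
    (absolutelyContinuousOnInterval_of_locallyLipschitz hg r s) (hB.mono fun _ h _ => h)
  nlinarith

lemma abs_sub_le_of_ae_abs_deriv_le_rpow {C e : ℝ} (he : 0 ≤ e) (hC : 0 ≤ C)
    (hg : LocallyLipschitz g) (hB : ∀ᵐ s, |deriv g s| ≤ C * (1 + |s| ^ e)) (s r : ℝ) :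
    |g s - g r| ≤ C * (1 + |s| ^ e + |r| ^ e) * |s - r| := by
  wlog hrs : r ≤ s generalizing s r
  · rw [abs_sub_comm, abs_sub_comm s, add_right_comm]
    exact this r s (le_of_not_ge hrs)
  rw [abs_of_nonneg (sub_nonneg.2 hrs)]
  refine abs_sub_le_of_ae_abs_deriv_le hrs
    (absolutelyContinuousOnInterval_of_locallyLipschitz hg r s)
    (hB.mono fun x hx hxI => hx.trans ?_)
  have hpow : |x| ^ e ≤ |s| ^ e + |r| ^ e := by
    have hs := Real.rpow_nonneg (abs_nonneg s) e
    have hr := Real.rpow_nonneg (abs_nonneg r) e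
    rcases le_max_iff.1 (abs_le_max_abs_abs hxI.1 hxI.2) with h | h
    · linarith [Real.rpow_le_rpow (abs_nonneg x) h he]
    · linarith [Real.rpow_le_rpow (abs_nonneg x) h he]
  rw [add_assoc]
  gcongr

lemma locallyLipschitz_of_forall_Icc
    (hg : ∀ n : ℕ, ∃ M : ℝ≥0, LipschitzOnWith M g (Icc (-n) n)) : LocallyLipschitz g := by
  intro s
  obtain ⟨n, hn⟩ := exists_nat_gt |s|
  obtain ⟨M, hM⟩ := hg n
  exact ⟨M, _, Icc_mem_nhds (abs_lt.1 hn).1 (abs_lt.1 hn).2, hM⟩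

end RealFunctions

section PolynomialGrowth

variable {E F : Type*} [SeminormedAddCommGroup E] [SeminormedAddCommGroup F] {G : E → F}
  {C D : ℝ≥0} {e : ℝ}

lemma lipschitzOnWith_closedBall_of_norm_sub_le (he : 0 ≤ e)
    (hG : ∀ u v, ‖G u - G v‖ ≤ C * (D + ‖u‖ ^ e + ‖v‖ ^ e) * ‖u - v‖) (k : ℝ≥0) :
    LipschitzOnWith (C * (D + k ^ e + k ^ e)) G (Metric.closedBall 0 k) := by
  refine LipschitzOnWith.of_dist_le_mul fun u hu v hv => ?_
  rw [mem_closedBall_zero_iff] at hu hv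
  rw [dist_eq_norm, dist_eq_norm]
  push_cast
  refine (hG u v).trans ?_
  gcongr

lemma continuous_of_norm_sub_le (he : 0 ≤ e)
    (hG : ∀ u v, ‖G u - G v‖ ≤ C * (D + ‖u‖ ^ e + ‖v‖ ^ e) * ‖u - v‖) : Continuous G :=
  continuous_iff_continuousAt.2 fun u =>
    (lipschitzOnWith_closedBall_of_norm_sub_le he hG (‖u‖₊ + 1)).continuousOn.continuousAt <|
      mem_of_superset (Metric.ball_mem_nhds u one_pos) fun v hv => by
        rw [mem_ball_iff_norm] at hv
        rw [mem_closedBall_zero_iff]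
        push_cast
        linarith [norm_sub_norm_le v u]

end PolynomialGrowth

section Reaction

variable {Ω : Type*} [MeasurableSpace Ω] {μ : Measure Ω} {f : Ω → ℝ → ℝ}

lemma aestronglyMeasurable_comp_simpleFunc (hf : ∀ s, AEStronglyMeasurable (fun x => f x s) μ)
    (w : SimpleFunc Ω ℝ) : AEStronglyMeasurable (fun x => f x (w x)) μ := by
  have hsum : (fun x => f x (w x)) =
      fun x => ∑ c ∈ w.range, (w ⁻¹' {c}).indicator (fun x => f x c) x := by
    funext x
    rw [Finset.sum_eq_single (w x)]
    · simp
    · exact fun c _ hc => indicator_of_notMem (fun h => hc (by simpa using h.symm)) _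
    · exact fun h => absurd (w.mem_range_self x) h
  rw [hsum]
  exact Finset.aestronglyMeasurable_fun_sum _ fun c _ => (hf c).indicator (w.measurableSet_fiber c)

lemma aestronglyMeasurable_comp_of_ae_continuous
    (hf : ∀ s, AEStronglyMeasurable (fun x => f x s) μ) (hc : ∀ᵐ x ∂μ, Continuous (f x))
    {u : Ω → ℝ} (hu : AEStronglyMeasurable u μ) : AEStronglyMeasurable (fun x => f x (u x)) μ := by
  have hmk : AEStronglyMeasurable (fun x => f x (hu.mk u x)) μ := by
    refine aestronglyMeasurable_of_tendsto_ae atTop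
      (fun n => aestronglyMeasurable_comp_simpleFunc hf (hu.stronglyMeasurable_mk.approx n)) ?_
    filter_upwards [hc] with x hx
    exact (hx.tendsto _).comp (hu.stronglyMeasurable_mk.tendsto_approx x)
  refine hmk.congr ?_
  filter_upwards [hu.ae_eq_mk] with x hx
  rw [hx]

lemma ae_abs_le_of_memLp_top {g : Ω → ℝ} (hg : MemLp g ⊤ μ) :
    ∀ᵐ x ∂μ, |g x| ≤ (eLpNorm g ⊤ μ).toNNReal := by
  filter_upwards [enorm_ae_le_eLpNormEssSup g μ] with x hx
  rw [← eLpNorm_exponent_top] at hx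
  have habs := ENNReal.toReal_mono hg.2.ne hx
  rwa [toReal_enorm, Real.norm_eq_abs] at habs

/-- `f` is an admissible reaction term: a Carathéodory function with `f(·, 0) ∈ L^∞(Ω)` which is
one-sided Lipschitz in `s` with constant `b`, and locally Lipschitz in `s` with a constant growing
like `C |s|^(ρ - 1)`. This is what the conditions `∂f/∂s ≤ β` and `|∂f/∂s| ≤ C (1 + |s|^(ρ - 1))`
amount to once integrated in `s`. -/
structure IsReaction (μ : Measure Ω) (f : Ω → ℝ → ℝ) (b C : ℝ≥0) (ρ : ℝ) : Prop where
  aestronglyMeasurable : ∀ s, AEStronglyMeasurable (fun x => f x s) μ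
  memLp_zero : MemLp (fun x => f x 0) ⊤ μ
  sub_mul_sub_le : ∀ᵐ x ∂μ, ∀ s r, (f x s - f x r) * (s - r) ≤ b * (s - r) ^ 2
  abs_sub_le : ∀ᵐ x ∂μ, ∀ s r,
    |f x s - f x r| ≤ C * (1 + |s| ^ (ρ - 1) + |r| ^ (ρ - 1)) * |s - r|

lemma isReaction_of_ae_deriv {ρ : ℝ} (hρ : 1 ≤ ρ)
    (hfmeas : ∀ s : ℝ, AEStronglyMeasurable (fun x => f x s) μ)
    (hfLip : ∀ R : ℝ, ∃ M : ℝ≥0, ∀ᵐ x ∂μ, LipschitzOnWith M (f x) (Icc (-R) R))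
    (hf0 : MemLp (fun x => f x 0) ⊤ μ) {β : Ω → ℝ} (hβ : MemLp β ⊤ μ)
    (hfβ : ∀ᵐ x ∂μ, ∀ᵐ s : ℝ, deriv (f x) s ≤ β x) {C : ℝ}
    (hfC : ∀ᵐ x ∂μ, ∀ᵐ s : ℝ, |deriv (f x) s| ≤ C * (1 + |s| ^ (ρ - 1))) :
    IsReaction μ f (eLpNorm β ⊤ μ).toNNReal ‖C‖₊ ρ := by
  have hlip : ∀ᵐ x ∂μ, LocallyLipschitz (f x) := by
    choose M hM using fun n : ℕ => hfLip n
    filter_upwards [ae_all_iff.2 hM] with x hx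
    exact locallyLipschitz_of_forall_Icc fun n => ⟨M n, hx n⟩
  refine ⟨hfmeas, hf0, ?_, ?_⟩
  · filter_upwards [hlip, hfβ, ae_abs_le_of_memLp_top hβ] with x hx hderiv hbound
    exact sub_mul_sub_le_of_ae_deriv_le hx
      (hderiv.mono fun s hs => hs.trans ((le_abs_self _).trans hbound))
  · filter_upwards [hlip, hfC] with x hx hderiv
    refine abs_sub_le_of_ae_abs_deriv_le_rpow (sub_nonneg.2 hρ) (norm_nonneg C) hx
      (hderiv.mono fun s hs => hs.trans ?_)
    gcongr
    exact le_abs_self C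

namespace IsReaction

variable {b C : ℝ≥0} {ρ : ℝ}

lemma sub_mul (hf : IsReaction μ f b C ρ) {h : Ω → ℝ} (hh : MemLp h ⊤ μ) :
    IsReaction μ (fun x s => f x s - h x * s) (b + (eLpNorm h ⊤ μ).toNNReal)
      (C + (eLpNorm h ⊤ μ).toNNReal) ρ where
  aestronglyMeasurable s := (hf.aestronglyMeasurable s).sub (hh.1.mul_const s)
  memLp_zero := by simpa using hf.memLp_zero
  sub_mul_sub_le := by
    filter_upwards [hf.sub_mul_sub_le, ae_abs_le_of_memLp_top hh] with x hx hbound s r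
    have hneg := mul_le_mul_of_nonneg_right ((neg_le_abs _).trans hbound) (sq_nonneg (s - r))
    rw [NNReal.coe_add]
    linarith [hx s r]
  abs_sub_le := by
    filter_upwards [hf.abs_sub_le, ae_abs_le_of_memLp_top hh] with x hx hbound s r
    have hone : 1 ≤ 1 + |s| ^ (ρ - 1) + |r| ^ (ρ - 1) := by
      linarith [Real.rpow_nonneg (abs_nonneg s) (ρ - 1), Real.rpow_nonneg (abs_nonneg r) (ρ - 1)]
    rw [NNReal.coe_add]
    calc |f x s - h x * s - (f x r - h x * r)|
        = |(f x s - f x r) - h x * (s - r)| := by congr 1; ring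
      _ ≤ |f x s - f x r| + |h x| * |s - r| := (abs_sub _ _).trans_eq (by rw [abs_mul])
      _ ≤ C * (1 + |s| ^ (ρ - 1) + |r| ^ (ρ - 1)) * |s - r|
          + (eLpNorm h ⊤ μ).toNNReal * (1 + |s| ^ (ρ - 1) + |r| ^ (ρ - 1)) * |s - r| := by
        refine add_le_add (hx s r) (mul_le_mul_of_nonneg_right ?_ (abs_nonneg _))
        exact hbound.trans (le_mul_of_one_le_right (NNReal.coe_nonneg _) hone)
      _ = _ := by ring

lemma aestronglyMeasurable_comp (hf : IsReaction μ f b C ρ) (hρ : 1 ≤ ρ) {u : Ω → ℝ}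
    (hu : AEStronglyMeasurable u μ) : AEStronglyMeasurable (fun x => f x (u x)) μ := by
  refine aestronglyMeasurable_comp_of_ae_continuous hf.aestronglyMeasurable ?_ hu
  filter_upwards [hf.abs_sub_le] with x hx
  exact continuous_of_norm_sub_le (C := C) (D := 1) (sub_nonneg.2 hρ) hx

end IsReaction

end Reaction

section Nemytskii

instance holderTriple_mul_ofReal (p : ℝ≥0∞) (ρ : ℝ) [hρ : Fact (1 < ρ)] :
    ENNReal.HolderTriple (p * ENNReal.ofReal ρ / ENNReal.ofReal (ρ - 1))
      (p * ENNReal.ofReal ρ) p where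
  inv_add_inv_eq_inv := by
    have hρ₀ : ENNReal.ofReal ρ ≠ 0 := by simpa using one_pos.trans hρ.out
    have hρ₁ : ENNReal.ofReal (ρ - 1) ≠ 0 := by simpa using hρ.out
    have hsum : ENNReal.ofReal (ρ - 1) + 1 = ENNReal.ofReal ρ := by
      rw [← ENNReal.ofReal_one, ← ENNReal.ofReal_add (sub_pos.2 hρ.out).le zero_le_one,
        sub_add_cancel]
    rw [ENNReal.inv_div (Or.inl ENNReal.ofReal_ne_top) (Or.inl hρ₁), ← one_div (p * _),
      ENNReal.div_add_div_same, hsum, mul_comm, ← one_div,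
      ← ENNReal.mul_div_mul_left 1 p hρ₀ ENNReal.ofReal_ne_top, mul_one]

instance holderTriple_top (ρ : ℝ) :
    ENNReal.HolderTriple (⊤ / ENNReal.ofReal (ρ - 1)) ⊤ ⊤ where
  inv_add_inv_eq_inv := by simp [ENNReal.top_div_of_ne_top]

variable {Ω : Type*} [MeasurableSpace Ω] {μ : Measure Ω} {f : Ω → ℝ → ℝ} {b C : ℝ≥0} {ρ : ℝ}

lemma eLpNorm_one_add_rpow_add_rpow_le {s : ℝ≥0∞} (hs : 1 ≤ s) {e : ℝ} (he : 0 < e)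
    {u v : Ω → ℝ} (hu : AEStronglyMeasurable u μ) (hv : AEStronglyMeasurable v μ) :
    eLpNorm (fun x => 1 + ‖u x‖ ^ e + ‖v x‖ ^ e) s μ ≤ eLpNorm (fun _ => (1 : ℝ)) s μ
      + eLpNorm u (s * ENNReal.ofReal e) μ ^ e + eLpNorm v (s * ENNReal.ofReal e) μ ^ e := by
  have hpow {w : Ω → ℝ} (hw : AEStronglyMeasurable w μ) :
      AEStronglyMeasurable (fun x => ‖w x‖ ^ e) μ :=
    (Real.continuous_rpow_const he.le).comp_aestronglyMeasurable hw.norm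
  rw [← eLpNorm_norm_rpow u he, ← eLpNorm_norm_rpow v he]
  exact (eLpNorm_add_le (aestronglyMeasurable_const.add (hpow hu)) (hpow hv) hs).trans
    (add_le_add_left (eLpNorm_add_le aestronglyMeasurable_const (hpow hu) hs) _)

namespace IsReaction

variable {p q : ℝ≥0∞} [hp : Fact (1 ≤ p)] [hρ : Fact (1 < ρ)]
  [hpq : ENNReal.HolderTriple (q / ENNReal.ofReal (ρ - 1)) q p]

lemma eLpNorm_sub_le (hf : IsReaction μ f b C ρ) {u v : Ω → ℝ}
    (hu : AEStronglyMeasurable u μ) (hv : AEStronglyMeasurable v μ) :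
    eLpNorm (fun x => f x (u x) - f x (v x)) p μ ≤
      C * ((eLpNorm (fun _ => (1 : ℝ)) (q / ENNReal.ofReal (ρ - 1)) μ
        + eLpNorm u q μ ^ (ρ - 1) + eLpNorm v q μ ^ (ρ - 1)) * eLpNorm (u - v) q μ) := by
  set s := q / ENNReal.ofReal (ρ - 1)
  have he : 0 < ρ - 1 := sub_pos.2 hρ.out
  have hsq : s * ENNReal.ofReal (ρ - 1) = q :=
    ENNReal.div_mul_cancel (by simpa using hρ.out) ENNReal.ofReal_ne_top
  have hs : 1 ≤ s := hp.out.trans (ENNReal.HolderTriple.le s q p)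
  set W : Ω → ℝ := fun x => 1 + ‖u x‖ ^ (ρ - 1) + ‖v x‖ ^ (ρ - 1)
  have hWmeas : AEStronglyMeasurable W μ := by
    have hcont := Real.continuous_rpow_const he.le
    exact (aestronglyMeasurable_const.add (hcont.comp_aestronglyMeasurable hu.norm)).add
      (hcont.comp_aestronglyMeasurable hv.norm)
  calc eLpNorm (fun x => f x (u x) - f x (v x)) p μ
      ≤ C * eLpNorm (W • (u - v)) p μ := by
        rw [← ENNReal.ofReal_coe_nnreal]
        refine eLpNorm_le_mul_eLpNorm_of_ae_le_mul ?_ p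
        filter_upwards [hf.abs_sub_le] with x hx
        have hWx : 0 ≤ W x := by positivity
        rw [Pi.smul_apply', smul_eq_mul, norm_mul, Real.norm_of_nonneg hWx, ← mul_assoc]
        exact hx _ _
    _ ≤ C * (eLpNorm W s μ * eLpNorm (u - v) q μ) := by
        gcongr
        exact eLpNorm_smul_le_mul_eLpNorm (hu.sub hv) hWmeas
    _ ≤ _ := by
        gcongr
        simpa only [hsq] using eLpNorm_one_add_rpow_add_rpow_le hs he hu hv

variable [IsFiniteMeasure μ]

lemma memLp_comp (hf : IsReaction μ f b C ρ) {u : Ω → ℝ} (hu : MemLp u q μ) :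
    MemLp (fun x => f x (u x)) p μ := by
  have he : 0 ≤ ρ - 1 := (sub_pos.2 hρ.out).le
  have hsub : MemLp (fun x => f x (u x) - f x 0) p μ := by
    refine ⟨(hf.aestronglyMeasurable_comp hρ.out.le hu.1).sub (hf.aestronglyMeasurable 0),
      (hf.eLpNorm_sub_le (q := q) hu.1 aestronglyMeasurable_zero).trans_lt ?_⟩
    refine ENNReal.mul_lt_top ENNReal.coe_lt_top
      (ENNReal.mul_lt_top ?_ (hu.sub MemLp.zero).2)
    refine ENNReal.add_lt_top.2 ⟨ENNReal.add_lt_top.2 ⟨(memLp_const 1).2, ?_⟩, ?_⟩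
    · exact ENNReal.rpow_lt_top_of_nonneg he hu.2.ne
    · exact ENNReal.rpow_lt_top_of_nonneg he MemLp.zero.2.ne
  simpa only [Pi.add_def, sub_add_cancel] using hsub.add (hf.memLp_zero.mono_exponent le_top)

/-- The Nemytskii operator `u ↦ f(·, u)` from `L^q(Ω)` to `L^p(Ω)`. The exponents are tied by
`1 / p = (ρ - 1) / q + 1 / q`, i.e. `q = p ρ`, where `p = q = ∞` is allowed. -/
noncomputable def nemytskii (hf : IsReaction μ f b C ρ) (u : Lp ℝ q μ) : Lp ℝ p μ :=
  (hf.memLp_comp (Lp.memLp u)).toLp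

lemma coeFn_nemytskii (hf : IsReaction μ f b C ρ) (u : Lp ℝ q μ) :
    (hf.nemytskii u : Lp ℝ p μ) =ᵐ[μ] fun x => f x (u x) :=
  MemLp.coeFn_toLp _

lemma norm_nemytskii_sub_le (hf : IsReaction μ f b C ρ) (u v : Lp ℝ q μ) :
    ‖(hf.nemytskii u - hf.nemytskii v : Lp ℝ p μ)‖ ≤
      C * ((eLpNorm (fun _ => (1 : ℝ)) (q / ENNReal.ofReal (ρ - 1)) μ).toNNReal
        + ‖u‖ ^ (ρ - 1) + ‖v‖ ^ (ρ - 1)) * ‖u - v‖ := by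
  have he : 0 ≤ ρ - 1 := (sub_pos.2 hρ.out).le
  have hle := hf.eLpNorm_sub_le (p := p) (q := q) (Lp.aestronglyMeasurable u)
    (Lp.aestronglyMeasurable v)
  have hone : eLpNorm (fun _ : Ω => (1 : ℝ)) (q / ENNReal.ofReal (ρ - 1)) μ ≠ ⊤ :=
    (memLp_const 1).2.ne
  have hnorm : ‖(hf.nemytskii u - hf.nemytskii v : Lp ℝ p μ)‖ₑ
      = eLpNorm (fun x => f x (u x) - f x (v x)) p μ := by
    rw [nemytskii, nemytskii, ← MemLp.toLp_sub, Lp.enorm_toLp]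
    rfl
  rw [← hnorm, ← eLpNorm_congr_ae (Lp.coeFn_sub u v), ← Lp.enorm_def, ← Lp.enorm_def,
    ← Lp.enorm_def, ← ENNReal.coe_toNNReal hone] at hle
  simp only [enorm_eq_nnnorm, ← ENNReal.coe_rpow_of_nonneg _ he] at hle
  rw [mul_assoc]
  exact_mod_cast hle

lemma continuous_nemytskii [Fact (1 ≤ q)] (hf : IsReaction μ f b C ρ) :
    Continuous (hf.nemytskii : Lp ℝ q μ → Lp ℝ p μ) :=
  continuous_of_norm_sub_le (sub_pos.2 hρ.out).le hf.norm_nemytskii_sub_le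

end IsReaction

end Nemytskii

section Dissipativity

variable {E : Type*} [NormedAddCommGroup E] [NormedSpace ℝ E] {T ω ε : ℝ}

lemma le_gronwallBound_of_neg_le_gronwallBound_neg {a c K x : ℝ}
    (h : -a ≤ gronwallBound (-c) (-K) ε x) : c ≤ gronwallBound a K ε x := by
  rcases eq_or_ne K 0 with rfl | hK
  · simp only [neg_zero, gronwallBound_K0] at h ⊢
    linarith
  · rw [gronwallBound_of_K_ne_0 (neg_ne_zero.2 hK)] at h
    rw [gronwallBound_of_K_ne_0 hK]
    have hexp : Real.exp (K * x) * Real.exp (-K * x) = 1 := by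
      rw [← Real.exp_add, neg_mul, add_neg_cancel, Real.exp_zero]
    have hmul := mul_le_mul_of_nonneg_left h (Real.exp_pos (K * x)).le
    have hrhs : Real.exp (K * x) * (-c * Real.exp (-K * x) + ε / -K * (Real.exp (-K * x) - 1))
        = -c + ε / K * (Real.exp (K * x) - 1) := by
      rw [div_neg]
      linear_combination (-c - ε / K) * hexp
    linarith

lemma eventually_slope_neg_norm_lt {w : ℝ → E} {w' : E} {s r : ℝ}
    (hw : HasDerivWithinAt w (-w') (Ioi s) s)
    (hd : ∀ δ > 0, (1 - δ * ω) * ‖w s‖ ≤ ‖w s - δ • w'‖ + δ * ε) (hr : ω * ‖w s‖ + ε < r) :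
    ∀ᶠ z in 𝓝[>] s, slope (fun t => -‖w t‖) s z < r := by
  have hη : 0 < r - (ω * ‖w s‖ + ε) := sub_pos.2 hr
  filter_upwards [(hasDerivWithinAt_iff_isLittleO.1 hw).def (half_pos hη), self_mem_nhdsWithin]
    with z hz hsz
  have hδ : 0 < z - s := sub_pos.2 hsz
  rw [Real.norm_of_nonneg hδ.le] at hz
  have hstep : ‖w s - (z - s) • w'‖ ≤ ‖w z‖ + (r - (ω * ‖w s‖ + ε)) / 2 * (z - s) := by
    have hsplit : w s - (z - s) • w' = w z - (w z - w s - (z - s) • -w') := by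
      rw [smul_neg]
      abel
    rw [hsplit]
    exact (norm_sub_le _ _).trans (by linarith)
  rw [slope_def_field, div_lt_iff₀ hδ]
  nlinarith [hd (z - s) hδ, mul_pos hδ hη]

-- Dissipativity bounds `‖w‖` at the present time by its values in the past, so Grönwall's
-- inequality is applied to `-‖w‖` with time reversed.
lemma norm_le_gronwallBound_of_dissipative {w w' : ℝ → E} (hT : 0 ≤ T)
    (hw : ∀ t ∈ Icc 0 T, HasDerivWithinAt w (w' t) (Icc 0 T) t)
    (hd : ∀ t ∈ Icc 0 T, ∀ δ > 0, (1 - δ * ω) * ‖w t‖ ≤ ‖w t - δ • w' t‖ + δ * ε) :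
    ‖w T‖ ≤ gronwallBound ‖w 0‖ ω ε T := by
  have hmaps : MapsTo (fun s => T - s) (Icc 0 T) (Icc 0 T) := fun s hs =>
    ⟨sub_nonneg.2 hs.2, sub_le_self T hs.1⟩
  have hcont : ContinuousOn (fun s => -‖w (T - s)‖) (Icc 0 T) := by
    have hw_cont : ContinuousOn w (Icc 0 T) := fun t ht => (hw t ht).continuousWithinAt
    exact (hw_cont.comp (by fun_prop) hmaps).norm.neg
  have hslope : ∀ s ∈ Ico 0 T, ∀ r, ω * ‖w (T - s)‖ + ε < r →
      ∃ᶠ z in 𝓝[>] s, (z - s)⁻¹ * (-‖w (T - z)‖ - -‖w (T - s)‖) < r := by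
    intro s hs r hr
    have hts : T - s ∈ Icc 0 T := hmaps (Ico_subset_Icc_self hs)
    have hder : HasDerivWithinAt (fun z => w (T - z)) (-w' (T - s)) (Icc 0 T) s := by
      have hcomp := (hw _ hts).scomp s ((hasDerivWithinAt_id s (Icc 0 T)).const_sub T) hmaps
      rwa [neg_one_smul] at hcomp
    exact (eventually_slope_neg_norm_lt
      (hder.mono_of_mem_nhdsWithin (Icc_mem_nhdsGT_of_mem hs)) (hd _ hts) hr).frequently
  have hgronwall := le_gronwallBound_of_liminf_deriv_right_le (δ := -‖w T‖) (K := -ω) (ε := ε)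
    hcont hslope (by rw [sub_zero])
    (fun s _ => by rw [neg_mul_neg]) T ⟨hT, le_rfl⟩
  rw [sub_self, sub_zero] at hgronwall
  exact le_gronwallBound_of_neg_le_gronwallBound_neg hgronwall

end Dissipativity

section Lp

lemma one_sub_mul_abs_le_abs_sub_mul {w g b δ : ℝ} (hδ : 0 ≤ δ) (hb : g * w ≤ b * w ^ 2) :
    (1 - δ * b) * |w| ≤ |w - δ * g| := by
  rcases eq_or_ne w 0 with rfl | hw
  · simpa using mul_nonneg (abs_nonneg δ) (abs_nonneg g)
  refine le_of_mul_le_mul_right ?_ (abs_pos.2 hw)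
  calc (1 - δ * b) * |w| * |w|
      = w ^ 2 - δ * (b * w ^ 2) := by rw [mul_assoc, abs_mul_abs_self]; ring
    _ ≤ w ^ 2 - δ * (g * w) := by gcongr
    _ = (w - δ * g) * w := by ring
    _ ≤ |w - δ * g| * |w| := (le_abs_self _).trans_eq (abs_mul _ _)

variable {Ω : Type*} [MeasurableSpace Ω] {μ : Measure Ω} {r : ℝ≥0∞} [Fact (1 ≤ r)]
  {T : ℝ}

lemma one_sub_mul_norm_le_norm_sub_smul {w g : Lp ℝ r μ} {b δ : ℝ} (hδ : 0 ≤ δ)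
    (hb : ∀ᵐ x ∂μ, g x * w x ≤ b * w x ^ 2) : (1 - δ * b) * ‖w‖ ≤ ‖w - δ • g‖ := by
  rcases le_or_gt (1 - δ * b) 0 with hneg | hpos
  · exact (mul_nonpos_of_nonpos_of_nonneg hneg (norm_nonneg w)).trans (norm_nonneg _)
  rw [← le_inv_mul_iff₀ hpos]
  refine Lp.norm_le_mul_norm_of_ae_le_mul ?_
  filter_upwards [hb, Lp.coeFn_sub w (δ • g), Lp.coeFn_smul δ g] with x hx hsub hsmul
  rw [le_inv_mul_iff₀ hpos, hsub, Pi.sub_apply, hsmul, Pi.smul_apply, smul_eq_mul]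
  exact one_sub_mul_abs_le_abs_sub_mul hδ hx

lemma norm_le_gronwallBound_of_ae_mul_le {w κ g : ℝ → Lp ℝ r μ} {b c ε : ℝ}
    (hw : ∀ t ∈ Icc 0 T, HasDerivWithinAt w (κ t + g t) (Icc 0 T) t)
    (hκ : ∀ t ∈ Icc 0 T, ‖κ t‖ ≤ c * ‖w t‖ + ε)
    (hg : ∀ t ∈ Icc 0 T, ∀ᵐ x ∂μ, g t x * w t x ≤ b * w t x ^ 2) :
    ∀ t ∈ Icc 0 T, ‖w t‖ ≤ gronwallBound ‖w 0‖ (c + b) ε t := by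
  intro t ht
  have hsub : Icc 0 t ⊆ Icc 0 T := Icc_subset_Icc_right ht.2
  refine norm_le_gronwallBound_of_dissipative ht.1
    (fun s hs => (hw s (hsub hs)).mono hsub) fun s hs δ hδ => ?_
  have hdiss := one_sub_mul_norm_le_norm_sub_smul hδ.le (hg s (hsub hs))
  have htri : ‖w s - δ • g s‖ ≤ ‖w s - δ • (κ s + g s)‖ + δ * ‖κ s‖ := by
    rw [← Real.norm_of_nonneg hδ.le, ← norm_smul, Real.norm_of_nonneg hδ.le]
    exact (norm_add_le _ _).trans_eq' (by congr 1; module)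
  nlinarith [mul_le_mul_of_nonneg_left (hκ s (hsub hs)) hδ.le]

lemma norm_sub_le_norm_sub_mul_exp {f : Ω → ℝ → ℝ} {u v κ₁ κ₂ g₁ g₂ : ℝ → Lp ℝ r μ} {b c : ℝ}
    (hf : ∀ᵐ x ∂μ, ∀ s r, (f x s - f x r) * (s - r) ≤ b * (s - r) ^ 2)
    (hu : ∀ t ∈ Icc 0 T, HasDerivWithinAt u (κ₁ t + g₁ t) (Icc 0 T) t)
    (hv : ∀ t ∈ Icc 0 T, HasDerivWithinAt v (κ₂ t + g₂ t) (Icc 0 T) t)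
    (hg₁ : ∀ t ∈ Icc 0 T, g₁ t =ᵐ[μ] fun x => f x (u t x))
    (hg₂ : ∀ t ∈ Icc 0 T, g₂ t =ᵐ[μ] fun x => f x (v t x))
    (hκ : ∀ t ∈ Icc 0 T, ‖κ₁ t - κ₂ t‖ ≤ c * ‖u t - v t‖) :
    ∀ t ∈ Icc 0 T, ‖u t - v t‖ ≤ ‖u 0 - v 0‖ * Real.exp ((c + b) * t) := by
  simp only [← gronwallBound_ε0]
  refine norm_le_gronwallBound_of_ae_mul_le (w := u - v) (κ := κ₁ - κ₂) (g := g₁ - g₂)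
    (fun t ht => ?_) (fun t ht => by simpa using hκ t ht) fun t ht => ?_
  · rw [Pi.sub_apply, Pi.sub_apply, ← add_sub_add_comm]
    exact (hu t ht).sub (hv t ht)
  · filter_upwards [hf, hg₁ t ht, hg₂ t ht, Lp.coeFn_sub (g₁ t) (g₂ t), Lp.coeFn_sub (u t) (v t)]
      with x hx hx₁ hx₂ hsub_g hsub_u
    rw [Pi.sub_apply, Pi.sub_apply, hsub_g, hsub_u, Pi.sub_apply, Pi.sub_apply, hx₁, hx₂]
    exact hx _ _

end Lp

section Schur

variable {α β : Type*} [MeasurableSpace α] [MeasurableSpace β] {μ : Measure α} {ν : Measure β}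
  {J : α → β → ℝ} {c : ℝ≥0}

lemma lintegral_mul_rpow_le {k v : β → ℝ≥0∞} (hk : AEMeasurable k ν) (hv : AEMeasurable v ν)
    {a : ℝ} (ha : 1 ≤ a) :
    (∫⁻ y, k y * v y ∂ν) ^ a ≤ (∫⁻ y, k y ∂ν) ^ (a - 1) * ∫⁻ y, k y * v y ^ a ∂ν := by
  have ha₀ : 0 < a := one_pos.trans_le ha
  have hinv : 0 ≤ 1 - a⁻¹ := sub_nonneg.2 (inv_le_one_of_one_le₀ ha)
  have hfactor (y : β) : k y * v y = k y ^ (1 - a⁻¹) * (k y * v y ^ a) ^ a⁻¹ := by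
    rw [ENNReal.mul_rpow_of_nonneg _ _ (inv_nonneg.2 ha₀.le), ENNReal.rpow_rpow_inv ha₀.ne',
      ← mul_assoc, ← ENNReal.rpow_add_of_nonneg _ _ hinv (inv_nonneg.2 ha₀.le), sub_add_cancel,
      ENNReal.rpow_one]
  have hholder := ENNReal.lintegral_mul_norm_pow_le hk (hk.mul (hv.pow_const a)) hinv
    (inv_nonneg.2 ha₀.le) (sub_add_cancel 1 a⁻¹)
  simp only [Pi.mul_apply, ← hfactor] at hholder
  refine (ENNReal.rpow_le_rpow hholder ha₀.le).trans_eq ?_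
  rw [ENNReal.mul_rpow_of_nonneg _ _ ha₀.le, ENNReal.rpow_inv_rpow ha₀.ne', ← ENNReal.rpow_mul,
    sub_mul, one_mul, inv_mul_cancel₀ ha₀.ne']

lemma lintegral_enorm_integral_kernel_rpow_le [SFinite μ] [SFinite ν]
    (hJ : AEStronglyMeasurable (Function.uncurry J) (μ.prod ν))
    (hrow : ∀ᵐ x ∂μ, ∫⁻ y, ‖J x y‖ₑ ∂ν ≤ c) (hcol : ∀ᵐ y ∂ν, ∫⁻ x, ‖J x y‖ₑ ∂μ ≤ c)
    {v : β → ℝ} (hv : AEStronglyMeasurable v ν) {a : ℝ} (ha : 1 ≤ a) :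
    ∫⁻ x, ‖∫ y, J x y * v y ∂ν‖ₑ ^ a ∂μ ≤ c ^ a * ∫⁻ y, ‖v y‖ₑ ^ a ∂ν := by
  have hpointwise : ∀ᵐ x ∂μ, ‖∫ y, J x y * v y ∂ν‖ₑ ^ a
      ≤ c ^ (a - 1) * ∫⁻ y, ‖J x y‖ₑ * ‖v y‖ₑ ^ a ∂ν := by
    filter_upwards [hrow, hJ.prodMk_left] with x hx hmeas
    calc ‖∫ y, J x y * v y ∂ν‖ₑ ^ a ≤ (∫⁻ y, ‖J x y‖ₑ * ‖v y‖ₑ ∂ν) ^ a := by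
          gcongr
          simpa only [enorm_mul] using enorm_integral_le_lintegral_enorm fun y => J x y * v y
      _ ≤ (∫⁻ y, ‖J x y‖ₑ ∂ν) ^ (a - 1) * ∫⁻ y, ‖J x y‖ₑ * ‖v y‖ₑ ^ a ∂ν :=
          lintegral_mul_rpow_le hmeas.enorm hv.enorm ha
      _ ≤ _ := by gcongr
  have hmeas : AEMeasurable (Function.uncurry fun x y => ‖J x y‖ₑ * ‖v y‖ₑ ^ a) (μ.prod ν) :=
    hJ.enorm.mul (hv.comp_snd.enorm.pow_const a)
  have hcol' : ∀ᵐ y ∂ν, ∫⁻ x, ‖J x y‖ₑ * ‖v y‖ₑ ^ a ∂μ ≤ c * ‖v y‖ₑ ^ a := by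
    filter_upwards [hcol, hJ.prod_swap.prodMk_left] with y hy hmeas_y
    have hsection : AEStronglyMeasurable (fun x => J x y) μ := hmeas_y
    rw [lintegral_mul_const'' _ hsection.enorm]
    gcongr
  have hca : (c : ℝ≥0∞) ^ (a - 1) ≠ ⊤ :=
    ENNReal.rpow_ne_top_of_nonneg (sub_nonneg.2 ha) ENNReal.coe_ne_top
  calc ∫⁻ x, ‖∫ y, J x y * v y ∂ν‖ₑ ^ a ∂μ
      ≤ ∫⁻ x, c ^ (a - 1) * ∫⁻ y, ‖J x y‖ₑ * ‖v y‖ₑ ^ a ∂ν ∂μ := lintegral_mono_ae hpointwise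
    _ = c ^ (a - 1) * ∫⁻ y, ∫⁻ x, ‖J x y‖ₑ * ‖v y‖ₑ ^ a ∂μ ∂ν := by
      rw [lintegral_const_mul' _ _ hca, lintegral_lintegral_swap hmeas]
    _ ≤ c ^ (a - 1) * ∫⁻ y, c * ‖v y‖ₑ ^ a ∂ν := by
      gcongr 1
      exact lintegral_mono_ae hcol'
    _ = c ^ a * ∫⁻ y, ‖v y‖ₑ ^ a ∂ν := by
      rw [lintegral_const_mul' _ _ ENNReal.coe_ne_top, ← mul_assoc]
      nth_rw 2 [← ENNReal.rpow_one (c : ℝ≥0∞)]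
      rw [← ENNReal.rpow_add_of_nonneg _ _ (sub_nonneg.2 ha) zero_le_one, sub_add_cancel]

lemma eLpNorm_integral_kernel_le [SFinite μ] [SFinite ν]
    (hJ : AEStronglyMeasurable (Function.uncurry J) (μ.prod ν))
    (hrow : ∀ᵐ x ∂μ, ∫⁻ y, ‖J x y‖ₑ ∂ν ≤ c) (hcol : ∀ᵐ y ∂ν, ∫⁻ x, ‖J x y‖ₑ ∂μ ≤ c)
    {v : β → ℝ} (hv : AEStronglyMeasurable v ν) {q : ℝ≥0∞} (hq : 1 ≤ q) :
    eLpNorm (fun x => ∫ y, J x y * v y ∂ν) q μ ≤ c * eLpNorm v q ν := by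
  rcases eq_or_ne q ⊤ with rfl | hq_top
  · rw [eLpNorm_exponent_top, eLpNorm_exponent_top]
    refine essSup_le_of_ae_le _ ?_
    filter_upwards [hrow, hJ.prodMk_left] with x hx hmeas
    calc ‖∫ y, J x y * v y ∂ν‖ₑ ≤ ∫⁻ y, ‖J x y‖ₑ * ‖v y‖ₑ ∂ν := by
          simpa only [enorm_mul] using enorm_integral_le_lintegral_enorm fun y => J x y * v y
      _ ≤ ∫⁻ y, ‖J x y‖ₑ * eLpNormEssSup v ν ∂ν := by
          refine lintegral_mono_ae ?_
          filter_upwards [enorm_ae_le_eLpNormEssSup v ν] with y hy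
          gcongr
      _ = (∫⁻ y, ‖J x y‖ₑ ∂ν) * eLpNormEssSup v ν := lintegral_mul_const'' _ hmeas.enorm
      _ ≤ c * eLpNormEssSup v ν := by gcongr
  · have hq₀ : q ≠ 0 := (one_pos.trans_le hq).ne'
    have ha : 1 ≤ q.toReal := by
      simpa using ENNReal.toReal_mono hq_top hq
    rw [eLpNorm_eq_lintegral_rpow_enorm_toReal hq₀ hq_top,
      eLpNorm_eq_lintegral_rpow_enorm_toReal hq₀ hq_top]
    refine (ENNReal.rpow_le_rpow (lintegral_enorm_integral_kernel_rpow_le hJ hrow hcol hv ha)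
      (by positivity)).trans_eq ?_
    rw [ENNReal.mul_rpow_of_nonneg _ _ (by positivity), ← ENNReal.rpow_mul,
      mul_one_div_cancel (one_pos.trans_le ha).ne', ENNReal.rpow_one]

lemma KernelMemLp.ae_lintegral_enorm_le {Ω : Type*} [MeasurableSpace Ω] {μ : Measure Ω}
    {J : Ω → Ω → ℝ} (hJ : KernelMemLp J ⊤ 1 μ) :
    ∀ᵐ x ∂μ, ∫⁻ y, ‖J x y‖ₑ ∂μ ≤ (eLpNorm (fun x => eLpNorm (J x) 1 μ) ⊤ μ).toNNReal := by
  rw [ENNReal.coe_toNNReal hJ.2.ne, eLpNorm_exponent_top]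
  filter_upwards [enorm_ae_le_eLpNormEssSup (fun x => eLpNorm (J x) 1 μ) μ] with x hx
  rwa [enorm_eq_self, eLpNorm_one_eq_lintegral_enorm] at hx

lemma KernelMemLp.swap_of_ae_symm {Ω : Type*} [MeasurableSpace Ω] {μ : Measure Ω} [SFinite μ]
    {J : Ω → Ω → ℝ} {a b : ℝ≥0∞} (hJ : KernelMemLp J a b μ)
    (hsymm : ∀ᵐ z ∂(μ.prod μ), J z.1 z.2 = J z.2 z.1) :
    KernelMemLp (fun x y => J y x) a b μ := by
  refine ⟨hJ.1.prod_swap, ?_⟩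
  rw [eLpNorm_congr_ae (g := fun x => eLpNorm (J x) b μ)]
  · exact hJ.2
  · filter_upwards [Measure.ae_ae_of_ae_prod hsymm] with x hx
    exact eLpNorm_congr_ae (hx.mono fun y hy => hy.symm)

end Schur

section Evolution

variable {E : Type*} [NormedAddCommGroup E] [NormedSpace ℝ E] [CompleteSpace E] {T : ℝ}

lemma forall_hasDerivWithinAt_iff_eq_add_integral {y G : ℝ → E} (hG : ContinuousOn G (Icc 0 T)) :
    (∀ t ∈ Icc 0 T, HasDerivWithinAt y (G t) (Icc 0 T) t) ↔
      ∀ t ∈ Icc 0 T, y t = y 0 + ∫ s in (0 : ℝ)..t, G s := by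
  have hint : ∀ t ∈ Icc 0 T, IntervalIntegrable G volume 0 t := fun t ht =>
    (hG.mono (Icc_subset_Icc_right ht.2)).intervalIntegrable_of_Icc ht.1
  refine ⟨fun hy t ht => ?_, fun hy t ht => ?_⟩
  · have hsub : Icc 0 t ⊆ Icc 0 T := Icc_subset_Icc_right ht.2
    rw [intervalIntegral.integral_eq_sub_of_hasDeriv_right_of_le ht.1
      (fun s hs => ((hy s (hsub hs)).mono hsub).continuousWithinAt)
      (fun s hs => (((hy s (hsub (Ioo_subset_Icc_self hs))).mono hsub).hasDerivAt
        (Icc_mem_nhds hs.1 hs.2)).hasDerivWithinAt) (hint t ht), add_sub_cancel]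
  · have : Fact (t ∈ Icc 0 T) := ⟨ht⟩
    exact ((intervalIntegral.integral_hasDerivWithinAt_right (hint t ht)
      (hG.stronglyMeasurableAtFilter_nhdsWithin measurableSet_Icc t) (hG t ht)).const_add
        (y 0)).congr hy (hy t ht)

lemma exp_smul_apply_exp_smul (A : E →L[ℝ] E) (t s : ℝ) (x : E) :
    NormedSpace.exp (t • A) (NormedSpace.exp (s • A) x) = NormedSpace.exp ((t + s) • A) x := by
  have hball (r : ℝ) : r • A ∈ Metric.eball (0 : E →L[ℝ] E)
      (NormedSpace.expSeries ℝ (E →L[ℝ] E)).radius := by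
    simp [NormedSpace.expSeries_radius_eq_top]
  rw [add_smul, NormedSpace.exp_add_of_commute_of_mem_ball (𝕂 := ℝ)
    (((Commute.refl A).smul_left t).smul_right s) (hball t) (hball s)]
  rfl

lemma exp_smul_apply_exp_neg_smul (A : E →L[ℝ] E) (t : ℝ) (x : E) :
    NormedSpace.exp (t • A) (NormedSpace.exp (-t • A) x) = x := by
  rw [exp_smul_apply_exp_smul, add_neg_cancel, zero_smul, NormedSpace.exp_zero, one_apply_eq_self]

lemma continuous_exp_smul (A : E →L[ℝ] E) : Continuous fun t : ℝ => NormedSpace.exp (t • A) :=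
  continuous_iff_continuousAt.2 fun t => (hasDerivAt_exp_smul_const A t).continuousAt

lemma hasDerivWithinAt_exp_neg_smul_iff (A : E →L[ℝ] E) {u : ℝ → E} {g : E} {s : Set ℝ} {t : ℝ} :
    HasDerivWithinAt u (A (u t) + g) s t ↔
      HasDerivWithinAt (fun r => NormedSpace.exp (-r • A) (u r))
        (NormedSpace.exp (-t • A) g) s t := by
  have hexp : HasDerivAt (fun r : ℝ => NormedSpace.exp (r • A)) (A * NormedSpace.exp (t • A)) t :=
    hasDerivAt_exp_smul_const' A t
  have hexp_neg : HasDerivAt (fun r : ℝ => NormedSpace.exp (-r • A))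
      ((-1 : ℝ) • (NormedSpace.exp (-t • A) * A)) t :=
    (hasDerivAt_exp_smul_const A (-t)).scomp t (hasDerivAt_neg t)
  refine ⟨fun hu => ?_, fun hy => ?_⟩
  · convert hexp_neg.hasDerivWithinAt.clm_apply hu using 1
    simp
  · have hu := hexp.hasDerivWithinAt.clm_apply hy
    simpa only [mul_apply_eq_comp, exp_smul_apply_exp_neg_smul] using hu

lemma forall_hasDerivWithinAt_iff_eq_duhamel (A : E →L[ℝ] E) {u g : ℝ → E}
    (hg : ContinuousOn g (Icc 0 T)) :
    (∀ t ∈ Icc 0 T, HasDerivWithinAt u (A (u t) + g t) (Icc 0 T) t) ↔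
      ∀ t ∈ Icc 0 T, u t = NormedSpace.exp (t • A) (u 0) +
        ∫ s in (0 : ℝ)..t, NormedSpace.exp ((t - s) • A) (g s) := by
  have hcont : ContinuousOn (fun s => NormedSpace.exp (-s • A) (g s)) (Icc 0 T) :=
    ((continuous_exp_smul A).comp continuous_neg).continuousOn.clm_apply hg
  have hpull : ∀ t ∈ Icc 0 T, ∫ s in (0 : ℝ)..t, NormedSpace.exp ((t - s) • A) (g s) =
      NormedSpace.exp (t • A) (∫ s in (0 : ℝ)..t, NormedSpace.exp (-s • A) (g s)) := by
    intro t ht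
    rw [← ContinuousLinearMap.intervalIntegral_comp_comm _
      ((hcont.mono (Icc_subset_Icc_right ht.2)).intervalIntegrable_of_Icc ht.1)]
    simp only [exp_smul_apply_exp_smul, ← sub_eq_add_neg]
  have hzero : NormedSpace.exp (-(0 : ℝ) • A) (u 0) = u 0 := by simp
  simp only [hasDerivWithinAt_exp_neg_smul_iff,
    forall_hasDerivWithinAt_iff_eq_add_integral hcont, hzero]
  refine forall₂_congr fun t ht => ?_
  rw [hpull t ht, ← map_add]
  constructor
  · intro h
    rw [← h, exp_smul_apply_exp_neg_smul]
  · intro h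
    rw [h, exp_smul_apply_exp_smul, neg_add_cancel, zero_smul, NormedSpace.exp_zero,
      one_apply_eq_self]

lemma tendstoUniformlyOn_comp_of_continuous {ι X Y Z : Type*} [TopologicalSpace X] [UniformSpace Y]
    [UniformSpace Z] {G : Y → Z} (hG : Continuous G) {s : Set X} (hs : IsCompact s)
    {l : Filter ι} {u : ι → X → Y} {v : X → Y} (hv : ContinuousOn v s)
    (huv : TendstoUniformlyOn u v l s) :
    TendstoUniformlyOn (fun n x => G (u n x)) (fun x => G (v x)) l s := by
  intro r hr
  have hGr := (hs.image_of_continuousOn hv).uniformContinuousAt_of_continuousAt G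
    (fun _ _ => hG.continuousAt) hr
  filter_upwards [huv _ hGr] with n hn x hx
  exact hn x hx (mem_image_of_mem v hx)

lemma exists_tendstoUniformlyOn_of_norm_sub_le {X Y : Type*} [NormedAddCommGroup Y]
    [CompleteSpace Y] {s : Set X} {u : ℕ → X → Y} {a : ℕ → Y} (ha : CauchySeq a)
    {M : ℝ} (hM : 0 < M) (hu : ∀ m n, ∀ x ∈ s, ‖u m x - u n x‖ ≤ ‖a m - a n‖ * M) :
    ∃ v : X → Y, TendstoUniformlyOn u v atTop s := by
  have hcauchy : UniformCauchySeqOn u atTop s := by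
    refine Metric.uniformCauchySeqOn_iff.2 fun ε hε => ?_
    obtain ⟨N, hN⟩ := Metric.cauchySeq_iff.1 ha (ε / M) (div_pos hε hM)
    refine ⟨N, fun m hm n hn x hx => ?_⟩
    have hmn := hN m hm n hn
    rw [dist_eq_norm, lt_div_iff₀ hM] at hmn
    exact (dist_eq_norm _ _).trans_lt ((hu m n x hx).trans_lt hmn)
  choose! v hv using fun x (hx : x ∈ s) => cauchySeq_tendsto_of_complete (hcauchy.cauchySeq hx)
  exact ⟨v, hcauchy.tendstoUniformlyOn_of_tendsto hv⟩

lemma hasDerivWithinAt_of_tendstoUniformlyOn {X : Type*} [NormedAddCommGroup X] [NormedSpace ℝ X]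
    (ι : X →L[ℝ] E) {G : X → E} (hG : Continuous G) {u : ℕ → ℝ → X} {v : ℝ → X}
    (hc : ∀ n, ContinuousOn (u n) (Icc 0 T))
    (hd : ∀ n, ∀ t ∈ Icc 0 T, HasDerivWithinAt (fun s => ι (u n s)) (G (u n t)) (Icc 0 T) t)
    (huv : TendstoUniformlyOn u v atTop (Icc 0 T)) :
    ∀ t ∈ Icc 0 T, HasDerivWithinAt (fun s => ι (v s)) (G (v t)) (Icc 0 T) t := by
  have hv : ContinuousOn v (Icc 0 T) := huv.continuousOn (Frequently.of_forall hc)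
  refine (forall_hasDerivWithinAt_iff_eq_add_integral (hG.comp_continuousOn hv)).2 ?_
  intro t ht
  have hι : ∀ s ∈ Icc 0 T, Tendsto (fun n => ι (u n s)) atTop (𝓝 (ι (v s))) := fun s hs =>
    (ι.continuous.tendsto _).comp (huv.tendsto_at hs)
  have hsub : uIcc 0 t ⊆ Icc 0 T := by
    rw [uIcc_of_le ht.1]
    exact Icc_subset_Icc_right ht.2
  have hintegral : Tendsto (fun n => ∫ s in (0 : ℝ)..t, G (u n s)) atTop
      (𝓝 (∫ s in (0 : ℝ)..t, G (v s))) :=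
    ((tendstoUniformlyOn_comp_of_continuous hG isCompact_Icc hv huv).mono hsub
      ).tendsto_intervalIntegral_of_continuousOn
        (Eventually.of_forall fun n => (hG.comp_continuousOn (hc n)).mono hsub)
  refine tendsto_nhds_unique (hι t ht) (((hι 0 ⟨le_rfl, ht.1.trans ht.2⟩).add hintegral).congr
    fun n => ?_)
  exact ((forall_hasDerivWithinAt_iff_eq_add_integral (hG.comp_continuousOn (hc n))).1
    (hd n) t ht).symm

lemma exists_hasDerivWithinAt_of_lipschitz_of_bounded {X : E → E} {K B : ℝ≥0}
    (hX : LipschitzWith K X) (hB : ∀ x, ‖X x‖ ≤ B) (x₀ : E) (hT : 0 ≤ T) :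
    ∃ u : ℝ → E, u 0 = x₀ ∧ ∀ t ∈ Icc 0 T, HasDerivWithinAt u (X (u t)) (Icc 0 T) t := by
  have hpicard : IsPicardLindelof (fun _ => X) (tmin := 0) (tmax := T) ⟨0, le_rfl, hT⟩ x₀
      (B * ⟨T, hT⟩) 0 B K :=
    { lipschitzOnWith := fun _ _ => hX.lipschitzOnWith
      continuousOn := fun _ _ => continuousOn_const
      norm_le := fun _ _ x _ => hB x
      mul_max_le := by
        rw [sub_zero, sub_self, max_eq_left hT, NNReal.coe_zero, sub_zero]
        exact le_rfl }
  exact hpicard.exists_eq_forall_mem_Icc_hasDerivWithinAt₀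

end Evolution

section Truncation

/-- Truncation of real numbers to `[-k, k]`. -/
def clamp (k : ℝ≥0) (s : ℝ) : ℝ := max (-k) (min k s)

lemma lipschitzWith_clamp (k : ℝ≥0) : LipschitzWith 1 (clamp k) :=
  (LipschitzWith.id.const_min (k : ℝ)).const_max (-k : ℝ)

lemma clamp_zero (k : ℝ≥0) : clamp k 0 = 0 := by simp [clamp]

lemma abs_clamp_le (k : ℝ≥0) (s : ℝ) : |clamp k s| ≤ k :=
  abs_le.2 ⟨le_max_left _ _, max_le (neg_le_self k.2) (min_le_left _ _)⟩

lemma clamp_eq_self {k : ℝ≥0} {s : ℝ} (hs : |s| ≤ k) : clamp k s = s := by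
  rw [clamp, min_eq_right (abs_le.1 hs).2, max_eq_right (abs_le.1 hs).1]

lemma exists_one_le_mul_clamp_eq {k : ℝ≥0} (hk : 0 < k) (s : ℝ) :
    ∃ a : ℝ, 1 ≤ a ∧ a * clamp k s = s := by
  have hk' : (0 : ℝ) < k := hk
  rcases le_or_gt |s| k with hs | hs
  · exact ⟨1, le_rfl, by rw [one_mul, clamp_eq_self hs]⟩
  refine ⟨|s| / k, (one_le_div hk').2 hs.le, ?_⟩
  rcases lt_abs.1 hs with hpos | hneg
  · rw [clamp, min_eq_left hpos.le, max_eq_right (by linarith), abs_of_pos (hk'.trans hpos),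
      div_mul_cancel₀ _ hk'.ne']
  · rw [clamp, min_eq_right (by linarith), max_eq_left (by linarith), abs_of_neg (by linarith),
      div_mul_eq_mul_div, neg_mul_neg, mul_div_cancel_right₀ _ hk'.ne']

lemma mul_clamp_le {k : ℝ≥0} (hk : 0 < k) {b : ℝ} (hb : 0 ≤ b) {φ : ℝ → ℝ}
    (hφ : ∀ s, φ s * s ≤ b * s ^ 2) (s : ℝ) : φ (clamp k s) * s ≤ b * s ^ 2 := by
  obtain ⟨a, ha, has⟩ := exists_one_le_mul_clamp_eq hk s
  have ha₀ : 0 ≤ a := zero_le_one.trans ha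
  calc φ (clamp k s) * s = a * (φ (clamp k s) * clamp k s) := by rw [mul_left_comm, has]
    _ ≤ a * (b * clamp k s ^ 2) := mul_le_mul_of_nonneg_left (hφ _) ha₀
    _ ≤ a ^ 2 * (b * clamp k s ^ 2) := by
      gcongr
      exact le_self_pow₀ ha two_ne_zero
    _ = b * s ^ 2 := by rw [mul_left_comm, ← mul_pow, has]

variable {Ω : Type*} [MeasurableSpace Ω] {μ : Measure Ω} {k : ℝ≥0}

/-- Pointwise truncation of functions in `L^∞(Ω)` to `[-k, k]`: a nonexpansive retraction onto the
closed ball of radius `k`. -/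
noncomputable def truncate (k : ℝ≥0) (u : Lp ℝ ⊤ μ) : Lp ℝ ⊤ μ :=
  (lipschitzWith_clamp k).compLp (clamp_zero k) u

lemma coeFn_truncate (k : ℝ≥0) (u : Lp ℝ ⊤ μ) : truncate k u =ᵐ[μ] fun x => clamp k (u x) :=
  (lipschitzWith_clamp k).coeFn_compLp (clamp_zero k) u

lemma lipschitzWith_truncate (k : ℝ≥0) : LipschitzWith 1 (truncate k : Lp ℝ ⊤ μ → Lp ℝ ⊤ μ) :=
  (lipschitzWith_clamp k).lipschitzWith_compLp (clamp_zero k)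

lemma norm_truncate_le_norm (k : ℝ≥0) (u : Lp ℝ ⊤ μ) : ‖truncate k u‖ ≤ ‖u‖ :=
  ((lipschitzWith_clamp k).norm_compLp_le (clamp_zero k) u).trans_eq (one_mul _)

lemma truncate_eq_self {u : Lp ℝ ⊤ μ} (hu : ‖u‖ ≤ k) : truncate k u = u := by
  refine Lp.ext ?_
  filter_upwards [coeFn_truncate k u, ae_abs_le_of_memLp_top (Lp.memLp u)] with x hx hux
  rw [hx]
  exact clamp_eq_self (hux.trans hu)

variable [IsFiniteMeasure μ]

lemma norm_truncate_le (k : ℝ≥0) (u : Lp ℝ ⊤ μ) : ‖truncate k u‖ ≤ k := by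
  have hle : ∀ᵐ x ∂μ, ‖truncate k u x‖ ≤ k := by
    filter_upwards [coeFn_truncate k u] with x hx
    rw [hx]
    exact abs_clamp_le k _
  simpa using Lp.norm_le_of_ae_bound k.2 hle

lemma exists_hasDerivWithinAt_truncate {F : Lp ℝ ⊤ μ → Lp ℝ ⊤ μ} {L : ℝ≥0}
    (hF : LipschitzOnWith L F (Metric.closedBall 0 k)) (u₀ : Lp ℝ ⊤ μ) {T : ℝ} (hT : 0 ≤ T) :
    ∃ u : ℝ → Lp ℝ ⊤ μ, u 0 = u₀ ∧
      ∀ t ∈ Icc 0 T, HasDerivWithinAt u (F (truncate k (u t))) (Icc 0 T) t := by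
  have hmem (u : Lp ℝ ⊤ μ) : truncate k u ∈ Metric.closedBall 0 (k : ℝ) :=
    mem_closedBall_zero_iff.2 (norm_truncate_le k u)
  have hlip : LipschitzWith (L * 1) (F ∘ truncate k) :=
    lipschitzOnWith_univ.1 (hF.comp (lipschitzWith_truncate k).lipschitzOnWith fun u _ => hmem u)
  have hbound (u : Lp ℝ ⊤ μ) : ‖F (truncate k u)‖ ≤ (‖F 0‖₊ + L * k : ℝ≥0) := by
    have hsub := hF.norm_sub_le (hmem u) (Metric.mem_closedBall_self k.2)
    rw [sub_zero] at hsub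
    calc ‖F (truncate k u)‖ ≤ ‖F 0‖ + ‖F (truncate k u) - F 0‖ := norm_le_norm_add_norm_sub' _ _
      _ ≤ ‖F 0‖ + L * ‖truncate k u‖ := by gcongr
      _ ≤ ‖F 0‖ + L * k := by gcongr; exact norm_truncate_le k u
  exact exists_hasDerivWithinAt_of_lipschitz_of_bounded hlip hbound u₀ hT

end Truncation

section Bounded

variable {Ω : Type*} [MeasurableSpace Ω] {μ : Measure Ω} [IsFiniteMeasure μ] {f : Ω → ℝ → ℝ}
  {b C : ℝ≥0} {ρ : ℝ} [hρ : Fact (1 < ρ)] {T : ℝ}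

lemma norm_le_gronwallBound_of_truncate (K : Lp ℝ ⊤ μ →L[ℝ] Lp ℝ ⊤ μ) (hf : IsReaction μ f b C ρ)
    {k : ℝ≥0} (hk : 0 < k) {u : ℝ → Lp ℝ ⊤ μ}
    (hu : ∀ t ∈ Icc 0 T, HasDerivWithinAt u
      (K (truncate k (u t)) + hf.nemytskii (truncate k (u t))) (Icc 0 T) t) :
    ∀ t ∈ Icc 0 T, ‖u t‖ ≤
      gronwallBound ‖u 0‖ (‖K‖ + b) ‖(hf.nemytskii (0 : Lp ℝ ⊤ μ) : Lp ℝ ⊤ μ)‖ t := by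
  set N : Lp ℝ ⊤ μ → Lp ℝ ⊤ μ := hf.nemytskii
  refine norm_le_gronwallBound_of_ae_mul_le (κ := fun t => K (truncate k (u t)) + N 0)
    (g := fun t => N (truncate k (u t)) - N 0) (fun t ht => ?_) (fun t _ => ?_) fun t _ => ?_
  · rw [add_add_sub_cancel]
    exact hu t ht
  · calc ‖K (truncate k (u t)) + N 0‖ ≤ ‖K‖ * ‖truncate k (u t)‖ + ‖N 0‖ :=
          (norm_add_le _ _).trans (add_le_add_left (K.le_opNorm _) _)
      _ ≤ ‖K‖ * ‖u t‖ + ‖N 0‖ := by gcongr; exact norm_truncate_le_norm k _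
  · filter_upwards [hf.sub_mul_sub_le, hf.coeFn_nemytskii (p := ⊤) (truncate k (u t)),
      hf.coeFn_nemytskii (p := ⊤) (0 : Lp ℝ ⊤ μ), coeFn_truncate k (u t), Lp.coeFn_zero ℝ ⊤ μ,
      Lp.coeFn_sub (N (truncate k (u t))) (N 0)] with x hx hN hN₀ htrunc hzero hsub
    rw [hsub, Pi.sub_apply, hN, hN₀, htrunc, hzero, Pi.zero_apply]
    exact mul_clamp_le (φ := fun s => f x s - f x 0) hk b.coe_nonneg
      (fun s => by simpa only [sub_zero] using hx s 0) _

lemma exists_lipschitzOnWith_add_nemytskii (K : Lp ℝ ⊤ μ →L[ℝ] Lp ℝ ⊤ μ)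
    (hf : IsReaction μ f b C ρ) (k : ℝ≥0) :
    ∃ L, LipschitzOnWith L (fun u => K u + hf.nemytskii u) (Metric.closedBall 0 k) :=
  ⟨_, K.lipschitz.lipschitzOnWith.add (lipschitzOnWith_closedBall_of_norm_sub_le
    (sub_pos.2 hρ.out).le hf.norm_nemytskii_sub_le k)⟩

lemma exists_hasDerivWithinAt_top (K : Lp ℝ ⊤ μ →L[ℝ] Lp ℝ ⊤ μ) (hf : IsReaction μ f b C ρ)
    (u₀ : Lp ℝ ⊤ μ) (hT : 0 ≤ T) :
    ∃ u : ℝ → Lp ℝ ⊤ μ, u 0 = u₀ ∧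
      ∀ t ∈ Icc 0 T, HasDerivWithinAt u (K (u t) + hf.nemytskii (u t)) (Icc 0 T) t := by
  set R : ℝ → ℝ := gronwallBound ‖u₀‖ (‖K‖ + b) ‖(hf.nemytskii (0 : Lp ℝ ⊤ μ) : Lp ℝ ⊤ μ)‖
  set k : ℝ≥0 := (R T).toNNReal + 1
  obtain ⟨L, hL⟩ := exists_lipschitzOnWith_add_nemytskii K hf k
  obtain ⟨u, hu₀, hu⟩ := exists_hasDerivWithinAt_truncate hL u₀ hT
  have hbound : ∀ t ∈ Icc 0 T, ‖u t‖ ≤ k := fun t ht =>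
    calc ‖u t‖ ≤ R t := by
          simpa only [hu₀] using norm_le_gronwallBound_of_truncate K hf (by positivity) hu t ht
      _ ≤ R T := gronwallBound_mono (norm_nonneg _) (norm_nonneg _) (by positivity) ht.2
      _ ≤ k := (Real.le_coe_toNNReal _).trans (by simp [k])
  refine ⟨u, hu₀, fun t ht => ?_⟩
  simpa only [truncate_eq_self (hbound t ht)] using hu t ht

end Bounded

section Inclusion

variable {Ω : Type*} [MeasurableSpace Ω] {μ : Measure Ω} [IsFiniteMeasure μ]
  {q r : ℝ≥0∞} [hq : Fact (1 ≤ q)] [hr : Fact (1 ≤ r)]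

/-- The inclusion `L^r(Ω) ⊆ L^q(Ω)`, for `q ≤ r` on a finite measure space, as a bounded operator.
It does not change the underlying class of functions. -/
noncomputable def lpIncl (hqr : q ≤ r) : Lp ℝ r μ →L[ℝ] Lp ℝ q μ :=
  LinearMap.mkContinuous
    { toFun := fun v => AddSubgroup.inclusion (Lp.antitone hqr) v
      map_add' := fun _ _ => rfl
      map_smul' := fun _ _ => rfl }
    (μ univ ^ (1 / q.toReal - 1 / r.toReal)).toReal
    (fun v => by
      have hexponent : 0 ≤ 1 / q.toReal - 1 / r.toReal := by
        rcases eq_or_ne r ⊤ with rfl | hr_top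
        · simp
        · exact sub_nonneg.2 (one_div_le_one_div_of_le
            (ENNReal.toReal_pos (one_pos.trans_le hq.out).ne' (ne_top_of_le_ne_top hr_top hqr))
            (ENNReal.toReal_mono hr_top hqr))
      rw [Lp.norm_def v, mul_comm, ← ENNReal.toReal_mul]
      exact ENNReal.toReal_mono (ENNReal.mul_lt_top (Lp.memLp v).2
        (ENNReal.rpow_lt_top_of_nonneg hexponent (measure_ne_top _ _))).ne
        (eLpNorm_le_eLpNorm_mul_rpow_measure_univ hqr (Lp.memLp v).1))

lemma coeFn_lpIncl (hqr : q ≤ r) (v : Lp ℝ r μ) : (lpIncl hqr v : Ω → ℝ) = v := rfl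

lemma lpIncl_injective (hqr : q ≤ r) : Function.Injective (lpIncl hqr : Lp ℝ r μ → Lp ℝ q μ) :=
  AddSubgroup.inclusion_injective (Lp.antitone hqr)

lemma denseRange_lpIncl_top : DenseRange (lpIncl le_top : Lp ℝ ⊤ μ → Lp ℝ q μ) := by
  rcases eq_or_ne q ⊤ with rfl | hq_top
  · exact Function.Surjective.denseRange fun u => ⟨u, rfl⟩
  refine fun u => Metric.mem_closure_iff.2 fun ε hε => ?_
  obtain ⟨g, hug, -⟩ := (Lp.memLp u).exists_simpleFunc_eLpNorm_sub_lt hq_top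
    (ε := ENNReal.ofReal ε) (by simpa using hε)
  have hg : MemLp g ⊤ μ := SimpleFunc.memLp_top g μ
  refine ⟨_, mem_range_self hg.toLp, ?_⟩
  rw [dist_eq_norm, Lp.norm_def]
  refine ENNReal.toReal_lt_of_lt_ofReal (hug.trans_eq' (eLpNorm_congr_ae ?_))
  filter_upwards [Lp.coeFn_sub u (lpIncl le_top hg.toLp), hg.coeFn_toLp] with x hsub hx
  rw [hsub, Pi.sub_apply, Pi.sub_apply, coeFn_lpIncl, hx]

end Inclusion

section Stability

variable {Ω : Type*} [MeasurableSpace Ω] {μ : Measure Ω} [IsFiniteMeasure μ]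
  {q : ℝ≥0∞} [hq : Fact (1 ≤ q)]

lemma exists_norm_lpIncl_nonlocalK_le {J : Ω → Ω → ℝ}
    (hJ : KernelMemLp J ⊤ (ENNReal.conjExponent ⊤) μ)
    (hcol : KernelMemLp (fun x y => J y x) ⊤ 1 μ) :
    ∃ c : ℝ≥0, ∀ v : Lp ℝ ⊤ μ,
      ‖(lpIncl le_top (nonlocalK hJ v) : Lp ℝ q μ)‖ ≤ c * ‖(lpIncl le_top v : Lp ℝ q μ)‖ := by
  have hrow : KernelMemLp J ⊤ 1 μ := by simpa [ENNReal.conjExponent] using hJ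
  set c := max (eLpNorm (fun x => eLpNorm (J x) 1 μ) ⊤ μ).toNNReal
    (eLpNorm (fun y => eLpNorm (fun x => J x y) 1 μ) ⊤ μ).toNNReal
  refine ⟨c, fun v => ?_⟩
  have hle : eLpNorm (nonlocalK hJ v) q μ ≤ c * eLpNorm v q μ := by
    rw [eLpNorm_congr_ae (coeFn_nonlocalK hJ v)]
    refine eLpNorm_integral_kernel_le hrow.1 ?_ ?_ (Lp.aestronglyMeasurable v) hq.out
    · filter_upwards [hrow.ae_lintegral_enorm_le] with x hx
      exact hx.trans (by simp [c])
    · filter_upwards [hcol.ae_lintegral_enorm_le] with y hy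
      exact hy.trans (by simp [c])
  rw [Lp.norm_def, Lp.norm_def, ← ENNReal.coe_toReal, ← ENNReal.toReal_mul]
  exact ENNReal.toReal_mono (ENNReal.mul_lt_top ENNReal.coe_lt_top (Lp.memLp _).2).ne hle

lemma norm_lpIncl_sub_le_mul_exp {f : Ω → ℝ → ℝ} {b C c : ℝ≥0} {ρ : ℝ} [Fact (1 < ρ)]
    (hf : IsReaction μ f b C ρ) {K : Lp ℝ ⊤ μ →L[ℝ] Lp ℝ ⊤ μ}
    (hK : ∀ v, ‖(lpIncl le_top (K v) : Lp ℝ q μ)‖ ≤ c * ‖(lpIncl le_top v : Lp ℝ q μ)‖)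
    {T : ℝ} {u v : ℝ → Lp ℝ ⊤ μ}
    (hu : ∀ t ∈ Icc 0 T, HasDerivWithinAt u (K (u t) + hf.nemytskii (u t)) (Icc 0 T) t)
    (hv : ∀ t ∈ Icc 0 T, HasDerivWithinAt v (K (v t) + hf.nemytskii (v t)) (Icc 0 T) t) :
    ∀ t ∈ Icc 0 T, ‖(lpIncl le_top (u t) : Lp ℝ q μ) - lpIncl le_top (v t)‖ ≤
      ‖(lpIncl le_top (u 0) : Lp ℝ q μ) - lpIncl le_top (v 0)‖ * Real.exp ((c + b) * t) := by
  set ι : Lp ℝ ⊤ μ →L[ℝ] Lp ℝ q μ := lpIncl le_top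
  have hderiv {w : ℝ → Lp ℝ ⊤ μ} (hw : ∀ t ∈ Icc 0 T,
      HasDerivWithinAt w (K (w t) + hf.nemytskii (w t)) (Icc 0 T) t) :
      ∀ t ∈ Icc 0 T, HasDerivWithinAt (fun s => ι (w s))
        (ι (K (w t)) + ι (hf.nemytskii (w t))) (Icc 0 T) t := fun t ht => by
    rw [← map_add]
    exact ι.hasFDerivAt.comp_hasDerivWithinAt t (hw t ht)
  refine norm_sub_le_norm_sub_mul_exp hf.sub_mul_sub_le (hderiv hu) (hderiv hv)
    (fun t _ => hf.coeFn_nemytskii (p := ⊤) (u t)) (fun t _ => hf.coeFn_nemytskii (p := ⊤) (v t))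
    fun t _ => ?_
  simpa only [map_sub] using hK (u t - v t)

end Stability

section Solutions

variable {Ω : Type*} [MeasurableSpace Ω] {μ : Measure Ω} [IsFiniteMeasure μ]
  {p : ℝ≥0∞} [Fact (1 ≤ p)] {ρ : ℝ} [Fact (1 < ρ)] {J : Ω → Ω → ℝ} {h : Ω → ℝ} {f : Ω → ℝ → ℝ}
  {b C : ℝ≥0} {T : ℝ} {u₀ : Lp ℝ (p * ENNReal.ofReal ρ) μ}
  {u v : ℝ → Lp ℝ (p * ENNReal.ofReal ρ) μ}

/-- The vector field `v ↦ K v + f(·, v)`, from `L^{pρ}(Ω)` to `L^p(Ω)`. The multiplication `-h v`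
of the evolution equation is counted as part of the reaction term `f`. -/
noncomputable def vectorField (hJ : KernelMemLp J p p.conjExponent μ) (hf : IsReaction μ f b C ρ)
    (v : Lp ℝ (p * ENNReal.ofReal ρ) μ) : Lp ℝ p μ :=
  nonlocalK hJ (incl v) + hf.nemytskii v

lemma coeFn_vectorField (hJ : KernelMemLp J p p.conjExponent μ) (hf : IsReaction μ f b C ρ)
    (v : Lp ℝ (p * ENNReal.ofReal ρ) μ) :
    vectorField hJ hf v =ᵐ[μ] fun x => (∫ y, J x y * v y ∂μ) + f x (v x) := by
  filter_upwards [Lp.coeFn_add (nonlocalK hJ (incl v)) (hf.nemytskii v),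
    coeFn_nonlocalK hJ (incl v), hf.coeFn_nemytskii (p := p) v] with x hadd hK hN
  rw [vectorField, hadd, Pi.add_apply, hK, hN, coeFn_incl]

lemma continuous_vectorField (hJ : KernelMemLp J p p.conjExponent μ)
    (hf : IsReaction μ f b C ρ) : Continuous (vectorField hJ hf) :=
  ((nonlocalK hJ).continuous.comp (lpIncl (le_mul_ofReal p ρ)).continuous).add
    hf.continuous_nemytskii

lemma vectorField_lpIncl_top (hJ : KernelMemLp J p p.conjExponent μ)
    (hJ' : KernelMemLp J ⊤ (ENNReal.conjExponent ⊤) μ) (hf : IsReaction μ f b C ρ)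
    (v : Lp ℝ ⊤ μ) :
    vectorField hJ hf (lpIncl le_top v) = lpIncl le_top (nonlocalK hJ' v + hf.nemytskii v) := by
  refine Lp.ext ?_
  filter_upwards [coeFn_vectorField hJ hf (lpIncl le_top v), coeFn_nonlocalK hJ' v,
    hf.coeFn_nemytskii (p := ⊤) v, Lp.coeFn_add (nonlocalK hJ' v) (hf.nemytskii v)]
    with x hx hK hN hadd
  rw [hx, coeFn_lpIncl, coeFn_lpIncl, hadd, Pi.add_apply, hK, hN]

lemma isStrongSolution_iff (hJ : KernelMemLp J p p.conjExponent μ)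
    (hg : IsReaction μ (fun x s => f x s - h x * s) b C ρ) :
    IsStrongSolution J h f u₀ T u ↔ ContinuousOn u (Icc 0 T) ∧ u 0 = u₀ ∧
      ∀ t ∈ Icc 0 T, HasDerivWithinAt (fun s => (incl (u s) : Lp ℝ p μ))
        (vectorField hJ hg (u t)) (Icc 0 T) t := by
  have hvec (t : ℝ) : vectorField hJ hg (u t) =ᵐ[μ] fun x =>
      (∫ y, J x y * u t y ∂μ) - h x * u t x + f x (u t x) := by
    filter_upwards [coeFn_vectorField hJ hg (u t)] with x hx
    rw [hx]
    ring
  constructor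
  · rintro ⟨hc, h0, u', -, hd, heq⟩
    refine ⟨hc, h0, fun t ht => ?_⟩
    rw [Lp.ext ((hvec t).trans (heq t ht).symm)]
    exact hd t ht
  · rintro ⟨hc, h0, hd⟩
    exact ⟨hc, h0, fun t => vectorField hJ hg (u t),
      (continuous_vectorField hJ hg).comp_continuousOn hc, hd, fun t _ => hvec t⟩

lemma IsStrongSolution.mono {S : ℝ} (hu : IsStrongSolution J h f u₀ T u) (hST : S ≤ T) :
    IsStrongSolution J h f u₀ S u := by
  obtain ⟨hc, h0, u', hc', hd, heq⟩ := hu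
  have hsub : Icc 0 S ⊆ Icc 0 T := Icc_subset_Icc_right hST
  exact ⟨hc.mono hsub, h0, u', hc'.mono hsub, fun t ht => (hd t (hsub ht)).mono hsub,
    fun t ht => heq t (hsub ht)⟩

lemma IsStrongSolution.congr (hT : 0 ≤ T) (hu : IsStrongSolution J h f u₀ T u)
    (hvu : EqOn v u (Icc 0 T)) : IsStrongSolution J h f u₀ T v := by
  obtain ⟨hc, h0, u', hc', hd, heq⟩ := hu
  refine ⟨hc.congr hvu, (hvu ⟨le_rfl, hT⟩).trans h0, u', hc',
    fun t ht => (hd t ht).congr (fun s hs => by rw [hvu hs]) (by rw [hvu ht]), fun t ht => ?_⟩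
  rw [hvu ht]
  exact heq t ht

lemma IsStrongSolution.eqOn (hJ : KernelMemLp J p p.conjExponent μ)
    (hg : IsReaction μ (fun x s => f x s - h x * s) b C ρ)
    (hu : IsStrongSolution J h f u₀ T u) (hv : IsStrongSolution J h f u₀ T v) :
    EqOn u v (Icc 0 T) := by
  obtain ⟨-, hu₀, hu'⟩ := (isStrongSolution_iff hJ hg).1 hu
  obtain ⟨-, hv₀, hv'⟩ := (isStrongSolution_iff hJ hg).1 hv
  intro t ht
  have hle := norm_sub_le_norm_sub_mul_exp hg.sub_mul_sub_le hu' hv'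
    (fun s _ => hg.coeFn_nemytskii (u s)) (fun s _ => hg.coeFn_nemytskii (v s))
    (fun s _ => by simpa only [map_sub] using (nonlocalK hJ).le_opNorm (incl (u s) - incl (v s)))
    t ht
  rw [hu₀, hv₀, sub_self, norm_zero, zero_mul, norm_le_zero_iff, sub_eq_zero] at hle
  exact lpIncl_injective (le_mul_ofReal p ρ) hle

lemma isMildSolution_iff_isStrongSolution (hJ : KernelMemLp J p p.conjExponent μ)
    (hh : MemLp h ⊤ μ) (hf : IsReaction μ f b C ρ) (hT : 0 ≤ T) :
    IsMildSolution hJ hh f u₀ T u ↔ IsStrongSolution J h f u₀ T u := by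
  have hN : Continuous (hf.nemytskii : Lp ℝ (p * ENNReal.ofReal ρ) μ → Lp ℝ p μ) :=
    hf.continuous_nemytskii
  have hvec (t : ℝ) : vectorField hJ (hf.sub_mul hh) (u t)
      = linOp hJ hh (incl (u t)) + hf.nemytskii (u t) := by
    refine Lp.ext ?_
    filter_upwards [coeFn_vectorField hJ (hf.sub_mul hh) (u t), coeFn_linOp hJ hh (incl (u t)),
      hf.coeFn_nemytskii (p := p) (u t),
      Lp.coeFn_add (linOp hJ hh (incl (u t))) (hf.nemytskii (u t))] with x hx hL hfx hadd
    rw [hx, hadd, Pi.add_apply, hL, hfx, coeFn_incl]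
    ring
  rw [isStrongSolution_iff hJ (hf.sub_mul hh)]
  simp only [hvec]
  constructor
  · rintro ⟨hc, g, -, hg, heq⟩
    have hgN : ∀ t ∈ Icc 0 T, g t = hf.nemytskii (u t) := fun t ht =>
      Lp.ext ((hg t ht).trans (hf.coeFn_nemytskii (u t)).symm)
    have hincl : (incl (u 0) : Lp ℝ p μ) = incl u₀ := by simpa using heq 0 ⟨le_rfl, hT⟩
    have hu₀ : u 0 = u₀ := lpIncl_injective (le_mul_ofReal p ρ) hincl
    rw [← hu₀] at heq
    refine ⟨hc, hu₀, fun t ht => hgN t ht ▸ ?_⟩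
    exact (forall_hasDerivWithinAt_iff_eq_duhamel (u := fun s => incl (u s)) (linOp hJ hh)
      ((hN.comp_continuousOn hc).congr hgN)).2 heq t ht
  · rintro ⟨hc, rfl, hd⟩
    have hNu := hN.comp_continuousOn hc
    exact ⟨hc, fun t => hf.nemytskii (u t), hNu.integrableOn_Icc,
      fun t _ => hf.coeFn_nemytskii (u t),
      (forall_hasDerivWithinAt_iff_eq_duhamel (linOp hJ hh) hNu).1 hd⟩

lemma exists_isStrongSolution (hrow : KernelMemLp J ⊤ 1 μ)
    (hcol : KernelMemLp (fun x y => J y x) ⊤ 1 μ) (hJ : KernelMemLp J p p.conjExponent μ)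
    (hg : IsReaction μ (fun x s => f x s - h x * s) b C ρ)
    (u₀ : Lp ℝ (p * ENNReal.ofReal ρ) μ) (hT : 0 ≤ T) :
    ∃ u, IsStrongSolution J h f u₀ T u := by
  have hJ' : KernelMemLp J ⊤ (ENNReal.conjExponent ⊤) μ := by
    simpa [ENNReal.conjExponent] using hrow
  let ι : Lp ℝ ⊤ μ →L[ℝ] Lp ℝ (p * ENNReal.ofReal ρ) μ := lpIncl le_top
  obtain ⟨_, ha_mem, ha⟩ := mem_closure_iff_seq_limit.1 (denseRange_lpIncl_top u₀)
  choose a ha_eq using ha_mem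
  obtain rfl : (fun n => ι (a n)) = _ := funext ha_eq
  choose w hw₀ hw using fun n => exists_hasDerivWithinAt_top (nonlocalK hJ') hg (a n) hT
  obtain ⟨c, hc⟩ := exists_norm_lpIncl_nonlocalK_le (q := p * ENNReal.ofReal ρ) hJ' hcol
  obtain ⟨u, hu⟩ := exists_tendstoUniformlyOn_of_norm_sub_le (u := fun n t => ι (w n t))
    (s := Icc 0 T) ha.cauchySeq (Real.exp_pos ((c + b) * T)) fun m n t ht => by
      rw [← hw₀ m, ← hw₀ n]
      refine (norm_lpIncl_sub_le_mul_exp hg hc (hw m) (hw n) t ht).trans ?_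
      gcongr
      exact ht.2
  have hcont : ∀ n, ContinuousOn (fun t => ι (w n t)) (Icc 0 T) := fun n =>
    ι.continuous.comp_continuousOn fun t ht => (hw n t ht).continuousWithinAt
  refine ⟨u, (isStrongSolution_iff hJ hg).2
    ⟨hu.continuousOn (Frequently.of_forall hcont), ?_, ?_⟩⟩
  · refine tendsto_nhds_unique (hu.tendsto_at ⟨le_rfl, hT⟩) ?_
    simpa only [hw₀] using ha
  · refine hasDerivWithinAt_of_tendstoUniformlyOn (lpIncl (le_mul_ofReal p ρ))
      (continuous_vectorField hJ hg) hcont (fun n t ht => ?_) hu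
    rw [vectorField_lpIncl_top hJ hJ' hg]
    exact (lpIncl le_top).hasFDerivAt.comp_hasDerivWithinAt t (hw n t ht)

lemma exists_forall_isStrongSolution (hrow : KernelMemLp J ⊤ 1 μ)
    (hcol : KernelMemLp (fun x y => J y x) ⊤ 1 μ) (hJ : KernelMemLp J p p.conjExponent μ)
    (hg : IsReaction μ (fun x s => f x s - h x * s) b C ρ)
    (u₀ : Lp ℝ (p * ENNReal.ofReal ρ) μ) :
    ∃ u, ∀ T, 0 ≤ T → IsStrongSolution J h f u₀ T u := by
  choose! S hS using fun T (hT : 0 ≤ T) => exists_isStrongSolution hrow hcol hJ hg u₀ hT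
  refine ⟨fun t => S (t + 1) t, fun T hT => (hS T hT).congr hT fun t ht => ?_⟩
  have ht₁ : t ≤ t + 1 := (lt_add_one t).le
  exact ((hS (t + 1) (ht.1.trans ht₁)).mono (min_le_right T (t + 1))).eqOn hJ hg
    ((hS T hT).mono (min_le_left T (t + 1))) ⟨ht.1, le_min ht.2 ht₁⟩

end Solutions

end NonlocalDiffusion

theorem theorem3p10_general {Ω : Type*} [MeasurableSpace Ω] {μ : Measure Ω} [IsFiniteMeasure μ]
    {p : ℝ≥0∞} [Fact (1 ≤ p)] {ρ : ℝ} [Fact (1 < ρ)] {J : Ω → Ω → ℝ}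
    (hrow : KernelMemLp J ⊤ 1 μ) (hcol : KernelMemLp (fun x y => J y x) ⊤ 1 μ)
    (hJ : KernelMemLp J p p.conjExponent μ) {h : Ω → ℝ} (hh : MemLp h ⊤ μ)
    {f : Ω → ℝ → ℝ} {b C : ℝ≥0} (hf : IsReaction μ f b C ρ)
    (u₀ : Lp ℝ (p * ENNReal.ofReal ρ) μ) :
    ∃ u : ℝ → Lp ℝ (p * ENNReal.ofReal ρ) μ,
      (∀ T : ℝ, 0 < T → IsMildSolution hJ hh f u₀ T u ∧ IsStrongSolution J h f u₀ T u) ∧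
      ∀ T : ℝ, 0 < T → ∀ v : ℝ → Lp ℝ (p * ENNReal.ofReal ρ) μ,
        (IsMildSolution hJ hh f u₀ T v ∨ IsStrongSolution J h f u₀ T v) →
          EqOn v u (Icc 0 T) := by
  have hg := hf.sub_mul hh
  obtain ⟨u, hu⟩ := exists_forall_isStrongSolution hrow hcol hJ hg u₀
  refine ⟨u, fun T hT => ⟨(isMildSolution_iff_isStrongSolution hJ hh hf hT.le).2 (hu T hT.le),
    hu T hT.le⟩, fun T hT v hv => ?_⟩
  rw [isMildSolution_iff_isStrongSolution hJ hh hf hT.le, or_self] at hv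
  exact hv.eqOn hJ hg (hu T hT.le)

theorem theorem3p10 {Ω : Type*} [MeasurableSpace Ω] (μ : Measure Ω) [IsFiniteMeasure μ]
    (p : ℝ≥0∞) [Fact (1 ≤ p)] (hp : p ≠ ⊤) (ρ : ℝ) [Fact (1 < ρ)]
    -- the kernel: symmetric, nonnegative, in `L^∞(L^1) ∩ L^p(L^{p'})`
    (J : Ω → Ω → ℝ)
    (hJsymm : ∀ᵐ z ∂(μ.prod μ), J z.1 z.2 = J z.2 z.1)
    (hJnonneg : ∀ᵐ z ∂(μ.prod μ), 0 ≤ J z.1 z.2)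
    (hJ₁ : KernelMemLp J ⊤ 1 μ)
    (hJ : KernelMemLp J p p.conjExponent μ)
    (h : Ω → ℝ) (hh : MemLp h ⊤ μ)
    -- the reaction term: measurable in `x`, locally Lipschitz in `s` uniformly in `x`
    (f : Ω → ℝ → ℝ)
    (hfmeas : ∀ s : ℝ, AEStronglyMeasurable (fun x => f x s) μ)
    (hfLip : ∀ R : ℝ, ∃ M : ℝ≥0, ∀ᵐ x ∂μ, LipschitzOnWith M (f x) (Icc (-R) R))
    (hf0 : MemLp (fun x => f x 0) ⊤ μ)
    (β : Ω → ℝ) (hβ : MemLp β ⊤ μ)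
    (hfβ : ∀ᵐ x ∂μ, ∀ᵐ s : ℝ, deriv (f x) s ≤ β x)
    (C : ℝ)
    (hfC : ∀ᵐ x ∂μ, ∀ᵐ s : ℝ, |deriv (f x) s| ≤ C * (1 + |s| ^ (ρ - 1)))
    (u₀ : Lp ℝ (p * ENNReal.ofReal ρ) μ) :
    ∃ u : ℝ → Lp ℝ (p * ENNReal.ofReal ρ) μ,
      (∀ T : ℝ, 0 < T → IsMildSolution hJ hh f u₀ T u ∧ IsStrongSolution J h f u₀ T u) ∧
      -- uniqueness, on every time interval
      ∀ T : ℝ, 0 < T → ∀ v : ℝ → Lp ℝ (p * ENNReal.ofReal ρ) μ,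
        (IsMildSolution hJ hh f u₀ T v ∨ IsStrongSolution J h f u₀ T v) →
          EqOn v u (Icc 0 T) := by
  exact theorem3p10_general hJ₁ (hJ₁.swap_of_ae_symm hJsymm) hJ hh
    (isReaction_of_ae_deriv (Fact.out : 1 < ρ).le hfmeas hfLip hf0 hβ hfβ hfC) u₀
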